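/- An increasing tree of size $n$ is a rooted plane tree (the children of each node are ordered) with nodes labelled $1,\dots,n$ such that labels increase along every path leading away from the root. Let $(\phi_i)_{i\ge 0}$ be a sequence of real numbers with $\phi_0>0$. The weight of a tree $T$ is $\omega(T)=\prod_{v}\phi_{d(v)}$, where $d(v)$ is the number of children of the node $v$, and $y_n$ is the total weight of all increasing trees of size $n$. Assume that the family is very simple, i.e. there are real constants $c_1,c_2$ with $c_1>0$ and $\alpha:=1+c_2/c_1>0$ such that $y_{n+1}=(c_1n+c_2)\,y_n$ for all $n\ge1$. A centroid of a tree is a node that minimises the sum of the distances to all other nodes, and $D(T)$ denotes the distance from the root of $T$ to the centroid nearest to the root. For a set $A$ of trees of size $n$ put $\mathbb P_n(A)=y_n^{-1}\sum_{T\in A}\omega(T)$; when all $\phi_i\ge0$, this is the probability that a random tree of size $n$, drawn according to the weights, lies in $A$. Then for every integer $h\ge0$ the limits $$t_h=\lim_{n\to\infty}\mathbb P_n(D\ge h),\qquad m_h=\lim_{n\to\infty}\mathbb P_n(D=h)$$ exist. If $\alpha\ne1$ they are $$t_h=\Bigl(\frac{\alpha}{\alpha-1}\Bigr)^h\Bigl(1-2^{1-\alpha}\sum_{j=0}^{h-1}\frac{((\alpha-1)\ln2)^j}{j!}\Bigr),$$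 $$m_h=\frac{\alpha^h}{(\alpha-1)^{h+1}}\Bigl[2^{1-\alpha}\Bigl(\sum_{j=0}^{h-1}\frac{((\alpha-1)\ln2)^j}{j!}+\frac{\alpha((\alpha-1)\ln2)^h}{h!}\Bigr)-1\Bigr],$$ and if $\alpha=1$ (recursive trees) they are $$t_h=\frac{(\ln2)^h}{h!},\qquad m_h=\frac{(\ln2)^h}{h!}-\frac{(\ln2)^{h+1}}{(h+1)!}.$$ If moreover $\phi_i\ge0$ for all $i$, then there is a probability distribution $\mathcal D$ on $\mathbb Z_{\ge0}$ with $\mathbb P(\mathcal D\ge h)=t_h$ and $\mathbb P(\mathcal D=h)=m_h$ for all $h\ge0$, and the law of the depth $D$ of the nearest centroid in a random tree of size $n$ converges weakly to $\mathcal D$ as $n\to\infty$. -/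

import Mathlib

open Filter Topology MeasureTheory

/-- The parent map of an increasing tree with the `n + 1` nodes `0, 1, …, n` (the node with label
`k ≥ 1` is the element `k - 1`). The root is `0`, and the parent of the node `i + 1` is one of the
nodes `0, …, i`, so that labels increase along every path that leads away from the root. -/
abbrev ParentMap (n : ℕ) : Type := (i : Fin n) → Fin (i.val + 1)

namespace ParentMap

variable {n : ℕ}

/-- `u` is the parent of `v`. -/
def IsParent (p : ParentMap n) (u v : Fin (n + 1)) : Prop :=
  ∃ i : Fin n, v = i.succ ∧ (p i).val = u.val

instance (p : ParentMap n) (u v : Fin (n + 1)) : Decidable (p.IsParent u v) :=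
  inferInstanceAs (Decidable (∃ i : Fin n, v = i.succ ∧ (p i).val = u.val))

/-- The set of children of the node `u`. -/
def children (p : ParentMap n) (u : Fin (n + 1)) : Finset (Fin (n + 1)) :=
  Finset.univ.filter (fun v => p.IsParent u v)

/-- The out-degree (number of children) of the node `u`. -/
def outDegree (p : ParentMap n) (u : Fin (n + 1)) : ℕ := (p.children u).card

/-- The underlying undirected graph of the tree. -/
def graph (p : ParentMap n) : SimpleGraph (Fin (n + 1)) :=
  SimpleGraph.fromRel p.IsParent

/-- The sum of the distances from `v` to all nodes of the tree. -/
noncomputable def totalDist (p : ParentMap n) (v : Fin (n + 1)) : ℕ :=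
  ∑ u, p.graph.dist v u

/-- A centroid is a node that minimises the sum (equivalently, the average) of the distances to
the other nodes. -/
def IsCentroid (p : ParentMap n) (v : Fin (n + 1)) : Prop :=
  ∀ w, p.totalDist v ≤ p.totalDist w

/-- The depth (distance from the root) of the centroid that is nearest to the root. -/
noncomputable def centroidDepth (p : ParentMap n) : ℕ :=
  sInf {d | ∃ v, p.IsCentroid v ∧ p.graph.dist 0 v = d}

end ParentMap

/-- Plane increasing trees with `n + 1` nodes: an increasing tree together with, for each node, an
ordering of its children (listed as first child, second child, …). -/
abbrev PlaneIncreasingTree (n : ℕ) : Type :=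
  Σ p : ParentMap n, (v : Fin (n + 1)) → (Fin (p.outDegree v) ≃ {u // u ∈ p.children v})

/-- The weight of a tree for the degree weights `φ`: the product of `φ (outdegree)` over all
nodes. -/
noncomputable def treeWeight (φ : ℕ → ℝ) {n : ℕ} (T : PlaneIncreasingTree n) : ℝ :=
  ∏ v, φ (T.1.outDegree v)

/-- The total weight `y_{n+1}` of all plane increasing trees with `n + 1` nodes. -/
noncomputable def totalWeight (φ : ℕ → ℝ) (n : ℕ) : ℝ :=
  ∑ T : PlaneIncreasingTree n, treeWeight φ T

/-- The depth of the nearest centroid of a plane increasing tree. -/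
noncomputable def PlaneIncreasingTree.depth {n : ℕ} (T : PlaneIncreasingTree n) : ℕ :=
  T.1.centroidDepth

/-- The proportion, by weight, of the trees with `n + 1` nodes that lie in `A`. For nonnegative
weights this is the probability of `A` for a random tree drawn according to the weights. -/
noncomputable def treeProb (φ : ℕ → ℝ) (n : ℕ) (A : Set (PlaneIncreasingTree n)) : ℝ :=
  (∑ T : PlaneIncreasingTree n, A.indicator (treeWeight φ) T) / totalWeight φ n

/-- The law of the depth of the nearest centroid of a random tree with `n + 1` nodes, drawn
according to the (nonnegative) weights. -/
noncomputable def depthLaw (φ : ℕ → ℝ) (n : ℕ) : Measure ℕ :=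
  ∑ T : PlaneIncreasingTree n,
    ENNReal.ofReal (treeWeight φ T / totalWeight φ n) • Measure.dirac T.depth

/-- The degree weights `φ` define a very simple family of increasing trees with parameters
`c₁, c₂`: leaves have positive weight, `c₁ > 0`, `1 + c₂ / c₁ > 0`, and the total weight `y_m` of
the trees of size `m` satisfies `y_{m+1} = (c₁ m + c₂) y_m` for all `m ≥ 1`. -/
structure IsVerySimple (φ : ℕ → ℝ) (c₁ c₂ : ℝ) : Prop where
  leaf_pos : 0 < φ 0
  c₁_pos : 0 < c₁
  alpha_pos : 0 < 1 + c₂ / c₁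
  ratio : ∀ n : ℕ, totalWeight φ (n + 1) = (c₁ * ((n : ℝ) + 1) + c₂) * totalWeight φ n

/-!
Cutting the edge above a non-root node `v` of a tree with `N` nodes shows that the sum of distances
changes by `N - 2 * size v` when one steps from the parent of `v` to `v`, where `size v` is the
number of nodes of the subtree at `v`. Hence the nearest centroid is the deepest node with
`size v > N / 2`. There is at most one such node at every depth, so `ℙ (D ≥ h)` is the *expected
number* of nodes at depth `h` with `size v > N / 2` (`ParentMap.heavyCount_half`,
`treeProb_le_depth`). Its computation is linear in the weights and needs no positivity of the degree
weights.

The assumption on the total weights forces the recursion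
`φ₀ (d + 1) φ_{d+1} = c₁ (α + d (1 - α)) φ_d` (`IsVerySimple.weight_recursion`). So the family is a
growth process: a tree with `n + 2` nodes arises from one with `n + 1` nodes by attaching a node to
`u` with weight `c₁ (α + d(u) (1 - α))`, which sums to `c₁ (s - 1 + α)` over a subtree of size `s`.
Let `W_h(n, m)` (`heavyWeight`) be the total weight of the trees with `n + 1` nodes, each counted
with the number of its nodes at depth `h` whose subtree has more than `m` nodes. The growth gives a
recursion in which `n` and `m` change simultaneously; by induction on `n` it implies a relation between
consecutive `m` for fixed `n` (`IsVerySimple.heavyWeight_threshold`), and the two combine to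
`W_{h+1}(n+1, m) = c₁ ((n+1) W_{h+1}(n, m) + α W_h(n, m))` (`IsVerySimple.heavyWeight_succ`), in which
`m` is fixed.

After division by `c₁ ^ n * n!` this says that the increment of the quantity for `h + 1` is
`α / (n + 1)` times the quantity for `h`. For `m ≤ n ≤ 2 m` this is a Riemann sum with step `1 / m` in
the variable `x = n / m` (`UniformApprox.step`), so up to a factor depending on `m` only the
quantities converge to functions `Ψ_h(x)` with `Ψ_{h+1}' = α Ψ_h / x` and `Ψ_{h+1}(1) = 0`, while
`Ψ_0(x) = x ^ (α - 1)` by Euler's limit formula for the Gamma function (`uniformApprox_ratio`). With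
`m` close to `n / 2` the limit of `ℙ (D ≥ h)` is `Ψ_h(2) / Ψ_0(2)`, and the differential equations are
solved by remainders of the exponential series (`isTailProfile_tailProfile`). These tend to zero, so
for nonnegative weights the limits are the tails of a probability distribution, and on `ℕ` the
convergence of the point masses implies weak convergence.
-/

/-! ### Increasing trees and their distances -/

namespace ParentMap

variable {n : ℕ}

/-- The parent of the non-root node `i + 1`, as a node of the tree. -/
def parent (p : ParentMap n) (i : Fin n) : Fin (n + 1) :=
  (p i).castLE (by omega)

lemma isParent_succ (p : ParentMap n) (u : Fin (n + 1)) (i : Fin n) :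
    p.IsParent u i.succ ↔ p.parent i = u := by
  constructor
  · rintro ⟨j, hj, h⟩
    obtain rfl := Fin.succ_injective _ hj
    exact Fin.ext h
  · rintro rfl
    exact ⟨i, rfl, rfl⟩

lemma not_isParent_zero (p : ParentMap n) (u : Fin (n + 1)) : ¬ p.IsParent u 0 := by
  rintro ⟨j, hj, -⟩
  exact (Fin.succ_ne_zero j) hj.symm

lemma parent_lt (p : ParentMap n) (i : Fin n) : p.parent i < i.succ := by
  have := (p i).isLt
  simpa [Fin.lt_def, parent] using this

/-- Induction along the tree, from the root to the leaves. -/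
lemma node_induction (p : ParentMap n) {P : Fin (n + 1) → Prop} (zero : P 0)
    (succ : ∀ i, P (p.parent i) → P i.succ) (v : Fin (n + 1)) : P v := by
  induction v using WellFoundedLT.induction with
  | ind v ih =>
    cases v using Fin.cases with
    | zero => exact zero
    | succ i => exact succ i (ih _ (p.parent_lt i))

/-- `u` lies on the path from the root to `v` (possibly `u = v`). -/
def IsAncestor (p : ParentMap n) (u v : Fin (n + 1)) : Prop :=
  Relation.ReflTransGen p.IsParent u v

lemma isAncestor_refl (p : ParentMap n) (v : Fin (n + 1)) : p.IsAncestor v v :=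
  Relation.ReflTransGen.refl

lemma isAncestor_zero (p : ParentMap n) (u : Fin (n + 1)) : p.IsAncestor u 0 ↔ u = 0 := by
  unfold IsAncestor
  rw [Relation.ReflTransGen.cases_tail_iff]
  simp [p.not_isParent_zero, eq_comm]

lemma isAncestor_succ (p : ParentMap n) (u : Fin (n + 1)) (i : Fin n) :
    p.IsAncestor u i.succ ↔ u = i.succ ∨ p.IsAncestor u (p.parent i) := by
  unfold IsAncestor
  rw [Relation.ReflTransGen.cases_tail_iff]
  simp [p.isParent_succ, eq_comm]

lemma zero_isAncestor (p : ParentMap n) (v : Fin (n + 1)) : p.IsAncestor 0 v :=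
  p.node_induction (p.isAncestor_refl 0) (fun i h => (p.isAncestor_succ _ i).2 (Or.inr h)) v

lemma IsAncestor.le {p : ParentMap n} {u v : Fin (n + 1)} (h : p.IsAncestor u v) : u ≤ v := by
  revert h
  refine p.node_induction (P := fun v => p.IsAncestor u v → u ≤ v) ?_ ?_ v
  · intro h
    exact ((p.isAncestor_zero u).1 h).le
  · intro i ih h
    rcases (p.isAncestor_succ u i).1 h with h | h
    · exact h.le
    · exact (ih h).trans (p.parent_lt i).le

lemma isAncestor_parent (p : ParentMap n) (i : Fin n) : p.IsAncestor (p.parent i) i.succ :=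
  (p.isAncestor_succ _ i).2 (Or.inr (p.isAncestor_refl _))

lemma not_isAncestor_parent (p : ParentMap n) (i : Fin n) :
    ¬ p.IsAncestor i.succ (p.parent i) :=
  fun h => absurd h.le (not_le.2 (p.parent_lt i))

lemma IsAncestor.total {p : ParentMap n} {u v w : Fin (n + 1)} (hu : p.IsAncestor u w)
    (hv : p.IsAncestor v w) : p.IsAncestor u v ∨ p.IsAncestor v u := by
  revert hu hv
  refine p.node_induction
    (P := fun w => p.IsAncestor u w → p.IsAncestor v w → p.IsAncestor u v ∨ p.IsAncestor v u)
    ?_ ?_ w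
  · intro hu hv
    rw [isAncestor_zero] at hu hv
    subst hu hv
    exact Or.inl (p.isAncestor_refl _)
  · intro i ih hu hv
    rcases (p.isAncestor_succ u i).1 hu with rfl | hu'
    · exact Or.inr hv
    · rcases (p.isAncestor_succ v i).1 hv with rfl | hv'
      · exact Or.inl hu
      · exact ih hu' hv'

lemma graph_adj_succ (p : ParentMap n) (i : Fin n) : p.graph.Adj (p.parent i) i.succ := by
  rw [graph, SimpleGraph.fromRel_adj]
  exact ⟨(p.parent_lt i).ne, Or.inl ((p.isParent_succ _ i).2 rfl)⟩

lemma graph_reachable_zero (p : ParentMap n) (v : Fin (n + 1)) : p.graph.Reachable 0 v :=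
  p.node_induction (P := fun v => p.graph.Reachable 0 v) (SimpleGraph.Reachable.refl _)
    (fun i h => h.trans (p.graph_adj_succ i).reachable) v

lemma graph_connected (p : ParentMap n) : p.graph.Connected :=
  ⟨fun u v => (p.graph_reachable_zero u).symm.trans (p.graph_reachable_zero v)⟩

/-- If every edge that enters `S` ends in `b`, then a walk into `S` from outside passes
through `b`. -/
lemma _root_.SimpleGraph.Walk.dist_lt_length_of_entry {V : Type*} {G : SimpleGraph V} {S : Set V}
    {b : V} (hS : ∀ x y, G.Adj x y → x ∉ S → y ∈ S → y = b) {a w : V} (q : G.Walk a w)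
    (ha : a ∉ S) (hw : w ∈ S) : G.dist b w + 1 ≤ q.length := by
  induction q with
  | nil => exact absurd hw ha
  | @cons x y z hxy q ih =>
    rw [SimpleGraph.Walk.length_cons]
    by_cases hy : y ∈ S
    · obtain rfl := hS _ _ hxy ha hy
      exact Nat.succ_le_succ (SimpleGraph.dist_le q)
    · exact (ih hy hw).trans (Nat.le_succ _)

/-- The edge from the node `i + 1` to its parent is the only one that joins a descendant of `i + 1`
to a non-descendant. -/
lemma adj_boundary (p : ParentMap n) (i : Fin n) {x y : Fin (n + 1)} (h : p.graph.Adj x y)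
    (hx : ¬ p.IsAncestor i.succ x) (hy : p.IsAncestor i.succ y) :
    x = p.parent i ∧ y = i.succ := by
  rw [graph, SimpleGraph.fromRel_adj] at h
  rcases h.2 with h | h
  · cases y using Fin.cases with
    | zero => exact absurd h (p.not_isParent_zero _)
    | succ j =>
      rw [isParent_succ] at h
      subst h
      rcases (p.isAncestor_succ _ j).1 hy with h | h
      · obtain rfl := Fin.succ_injective _ h
        exact ⟨rfl, rfl⟩
      · exact absurd h hx
  · exact absurd (Relation.ReflTransGen.tail hy h) hx

lemma dist_parent_of_isAncestor (p : ParentMap n) (i : Fin n) {w : Fin (n + 1)}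
    (hw : p.IsAncestor i.succ w) :
    p.graph.dist (p.parent i) w = p.graph.dist i.succ w + 1 := by
  apply le_antisymm
  · have h := p.graph_connected.dist_triangle (u := p.parent i) (v := i.succ) (w := w)
    rw [SimpleGraph.dist_eq_one_iff_adj.2 (p.graph_adj_succ i)] at h
    omega
  · obtain ⟨q, hq⟩ := p.graph_connected.exists_walk_length_eq_dist (p.parent i) w
    rw [← hq]
    exact q.dist_lt_length_of_entry (S := {w | p.IsAncestor i.succ w})
      (fun x y h hx hy => (p.adj_boundary i h hx hy).2) (p.not_isAncestor_parent i) hw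

lemma dist_succ_of_not_isAncestor (p : ParentMap n) (i : Fin n) {w : Fin (n + 1)}
    (hw : ¬ p.IsAncestor i.succ w) :
    p.graph.dist i.succ w = p.graph.dist (p.parent i) w + 1 := by
  apply le_antisymm
  · have h := p.graph_connected.dist_triangle (u := i.succ) (v := p.parent i) (w := w)
    rw [SimpleGraph.dist_eq_one_iff_adj.2 (p.graph_adj_succ i).symm] at h
    omega
  · obtain ⟨q, hq⟩ := p.graph_connected.exists_walk_length_eq_dist i.succ w
    rw [← hq]
    refine q.dist_lt_length_of_entry (S := {w | ¬ p.IsAncestor i.succ w})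
      (fun x y h hx hy => (p.adj_boundary i h.symm hy (not_not.1 hx)).1)
      (fun h => h (p.isAncestor_refl _)) hw

/-- The depth of the node `v`: its distance from the root. -/
noncomputable def nodeDepth (p : ParentMap n) (v : Fin (n + 1)) : ℕ := p.graph.dist 0 v

@[simp] lemma nodeDepth_zero (p : ParentMap n) : p.nodeDepth 0 = 0 := SimpleGraph.dist_self

lemma nodeDepth_succ (p : ParentMap n) (i : Fin n) :
    p.nodeDepth i.succ = p.nodeDepth (p.parent i) + 1 := by
  unfold nodeDepth
  rw [SimpleGraph.dist_comm, p.dist_succ_of_not_isAncestor i, SimpleGraph.dist_comm]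
  rw [isAncestor_zero]
  exact Fin.succ_ne_zero i

lemma nodeDepth_eq_zero (p : ParentMap n) {v : Fin (n + 1)} : p.nodeDepth v = 0 ↔ v = 0 := by
  cases v using Fin.cases with
  | zero => simp
  | succ i => simp [nodeDepth_succ, Fin.succ_ne_zero]

lemma IsAncestor.nodeDepth_le {p : ParentMap n} {u v : Fin (n + 1)} (h : p.IsAncestor u v) :
    p.nodeDepth u ≤ p.nodeDepth v := by
  induction h with
  | refl => exact le_rfl
  | @tail b c _ hbc ih =>
    obtain ⟨i, rfl, h⟩ := hbc
    rw [nodeDepth_succ, (p.isParent_succ b i).1 ⟨i, rfl, h⟩]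
    omega

lemma IsAncestor.eq_of_nodeDepth_le {p : ParentMap n} {u v : Fin (n + 1)} (h : p.IsAncestor u v)
    (hd : p.nodeDepth v ≤ p.nodeDepth u) : u = v := by
  cases v using Fin.cases with
  | zero => exact (p.isAncestor_zero u).1 h
  | succ i =>
    rcases (p.isAncestor_succ u i).1 h with h | h
    · exact h
    · have := h.nodeDepth_le
      rw [nodeDepth_succ] at hd
      omega

lemma IsAncestor.eq_of_nodeDepth_eq {p : ParentMap n} {u v w : Fin (n + 1)}
    (hu : p.IsAncestor u w) (hv : p.IsAncestor v w) (hd : p.nodeDepth u = p.nodeDepth v) :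
    u = v := by
  rcases hu.total hv with h | h
  · exact h.eq_of_nodeDepth_le hd.ge
  · exact (h.eq_of_nodeDepth_le hd.le).symm

/-! ### Subtree sizes and the centroid -/

open Classical in
/-- The set of descendants of `v`, including `v` itself. -/
noncomputable def descendants (p : ParentMap n) (v : Fin (n + 1)) : Finset (Fin (n + 1)) :=
  Finset.univ.filter (fun w => p.IsAncestor v w)

@[simp] lemma mem_descendants (p : ParentMap n) (v w : Fin (n + 1)) :
    w ∈ p.descendants v ↔ p.IsAncestor v w := by simp [descendants]

/-- The number of nodes of the subtree rooted at `v`, including `v` itself. -/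
noncomputable def subtreeSize (p : ParentMap n) (v : Fin (n + 1)) : ℕ := (p.descendants v).card

lemma subtreeSize_zero (p : ParentMap n) : p.subtreeSize 0 = n + 1 := by
  have : p.descendants 0 = Finset.univ := by
    ext w
    simp [p.zero_isAncestor w]
  simp [subtreeSize, this]

lemma subtreeSize_pos (p : ParentMap n) (v : Fin (n + 1)) : 0 < p.subtreeSize v :=
  Finset.card_pos.2 ⟨v, by simp [p.isAncestor_refl]⟩

lemma subtreeSize_succ_le (p : ParentMap n) (i : Fin n) : p.subtreeSize i.succ ≤ n := by
  have h : p.descendants i.succ ⊂ Finset.univ := by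
    rw [Finset.ssubset_univ_iff]
    intro h
    have h0 := Finset.mem_univ (0 : Fin (n + 1))
    rw [← h, mem_descendants, isAncestor_zero] at h0
    exact Fin.succ_ne_zero i h0
  have := Finset.card_lt_card h
  rw [Finset.card_univ, Fintype.card_fin] at this
  exact Nat.le_of_lt_succ this

lemma IsAncestor.subtreeSize_le {p : ParentMap n} {u v : Fin (n + 1)} (h : p.IsAncestor u v) :
    p.subtreeSize v ≤ p.subtreeSize u := by
  apply Finset.card_le_card
  intro w hw
  rw [mem_descendants] at hw ⊢
  exact Relation.ReflTransGen.trans h hw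

/-- Two different nodes of equal depth have disjoint subtrees, so at most one of these contains
more than half of the nodes. -/
lemma eq_of_nodeDepth_eq_of_subtreeSize (p : ParentMap n) {u v : Fin (n + 1)}
    (hd : p.nodeDepth u = p.nodeDepth v) (hs : n + 1 < p.subtreeSize u + p.subtreeSize v) :
    u = v := by
  by_contra hne
  have hdis : Disjoint (p.descendants u) (p.descendants v) := by
    rw [Finset.disjoint_left]
    intro w hu hv
    rw [mem_descendants] at hu hv
    exact hne (hu.eq_of_nodeDepth_eq hv hd)
  have h := Finset.card_le_univ (p.descendants u ∪ p.descendants v)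
  rw [Finset.card_union_of_disjoint hdis, Fintype.card_fin] at h
  unfold subtreeSize at hs
  omega

/-- Moving from a node to its child `i + 1` brings the descendants of `i + 1` closer by one and
takes all other nodes away by one. -/
lemma totalDist_succ (p : ParentMap n) (i : Fin n) :
    p.totalDist i.succ + 2 * p.subtreeSize i.succ = p.totalDist (p.parent i) + (n + 1) := by
  classical
  have h : ∀ w, p.graph.dist i.succ w + 2 * (if p.IsAncestor i.succ w then 1 else 0) =
      p.graph.dist (p.parent i) w + 1 := by
    intro w
    split_ifs with hw
    · rw [p.dist_parent_of_isAncestor i hw]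
    · rw [p.dist_succ_of_not_isAncestor i hw]
  have hsum := Finset.sum_congr rfl (fun w (_ : w ∈ Finset.univ) => h w)
  rw [Finset.sum_add_distrib, Finset.sum_add_distrib, ← Finset.mul_sum, Finset.sum_boole] at hsum
  simpa [totalDist, subtreeSize, descendants] using hsum

/-- Walking up from `v` to the first node whose subtree has more than half of the nodes does not
increase the total distance. -/
lemma exists_heavy_ancestor (p : ParentMap n) (v : Fin (n + 1)) :
    ∃ a, p.IsAncestor a v ∧ n + 1 < 2 * p.subtreeSize a ∧ p.totalDist a ≤ p.totalDist v := by
  refine p.node_induction (P := fun v => ∃ a, p.IsAncestor a v ∧ n + 1 < 2 * p.subtreeSize a ∧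
    p.totalDist a ≤ p.totalDist v) ?_ ?_ v
  · exact ⟨0, p.isAncestor_refl 0, by rw [subtreeSize_zero]; omega, le_rfl⟩
  · rintro i ⟨a, ha, hs, hd⟩
    by_cases h : n + 1 < 2 * p.subtreeSize i.succ
    · exact ⟨i.succ, p.isAncestor_refl _, h, le_rfl⟩
    · have := p.totalDist_succ i
      exact ⟨a, (p.isAncestor_succ _ i).2 (Or.inr ha), hs, by omega⟩

/-- Stepping down to a node whose subtree has more than half of the nodes decreases the total
distance by at least one. -/
lemma totalDist_le_of_heavy (p : ParentMap n) {a b : Fin (n + 1)} (hab : p.IsAncestor a b)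
    (hb : n + 1 < 2 * p.subtreeSize b) :
    p.totalDist b + p.nodeDepth b ≤ p.totalDist a + p.nodeDepth a := by
  revert hab hb
  refine p.node_induction (P := fun b => p.IsAncestor a b → n + 1 < 2 * p.subtreeSize b →
    p.totalDist b + p.nodeDepth b ≤ p.totalDist a + p.nodeDepth a) ?_ ?_ b
  · intro h _
    rw [(p.isAncestor_zero a).1 h]
  · intro i ih h hs
    rcases (p.isAncestor_succ a i).1 h with rfl | h
    · exact le_rfl
    · have h1 := ih h (hs.trans_le (Nat.mul_le_mul_left 2 (p.isAncestor_parent i).subtreeSize_le))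
      have h2 := p.totalDist_succ i
      rw [p.nodeDepth_succ i]
      omega

lemma exists_ancestor_nodeDepth (p : ParentMap n) (v : Fin (n + 1)) {h : ℕ}
    (hv : h ≤ p.nodeDepth v) : ∃ a, p.IsAncestor a v ∧ p.nodeDepth a = h := by
  revert hv
  refine p.node_induction (P := fun v => h ≤ p.nodeDepth v →
    ∃ a, p.IsAncestor a v ∧ p.nodeDepth a = h) ?_ ?_ v
  · intro hv
    rw [nodeDepth_zero] at hv
    exact ⟨0, p.isAncestor_refl 0, by simp; omega⟩
  · intro i ih hv
    rcases hv.eq_or_lt with hv | hv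
    · exact ⟨i.succ, p.isAncestor_refl _, hv.symm⟩
    · rw [nodeDepth_succ] at hv
      obtain ⟨a, ha, hd⟩ := ih (by omega)
      exact ⟨a, (p.isAncestor_succ _ i).2 (Or.inr ha), hd⟩

/-- The nearest centroid is the deepest node whose subtree contains more than half of the nodes. -/
lemma exists_deepest_heavy (p : ParentMap n) :
    ∃ b, n + 1 < 2 * p.subtreeSize b ∧ p.nodeDepth b = p.centroidDepth ∧
      ∀ v, n + 1 < 2 * p.subtreeSize v → p.nodeDepth v ≤ p.nodeDepth b := by
  classical
  obtain ⟨b, hb, hmax⟩ := Finset.exists_max_image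
    (Finset.univ.filter fun v => n + 1 < 2 * p.subtreeSize v) p.nodeDepth
    ⟨0, by simp only [Finset.mem_filter, Finset.mem_univ, true_and, subtreeSize_zero]; omega⟩
  simp only [Finset.mem_filter, Finset.mem_univ, true_and] at hb hmax
  -- `d` is the depth of the heavy node above `w`; that node also lies above `b`, as heavy subtrees of
  -- equal depth coincide. For `d < p.nodeDepth b` the inequality is strict.
  have key : ∀ w, ∃ d ≤ p.nodeDepth w,
      d ≤ p.nodeDepth b ∧ p.totalDist b + p.nodeDepth b ≤ p.totalDist w + d := by
    intro w
    obtain ⟨a, haw, ha, hle⟩ := p.exists_heavy_ancestor w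
    obtain ⟨c, hcb, hc⟩ := p.exists_ancestor_nodeDepth b (hmax a ha)
    obtain rfl : c = a := p.eq_of_nodeDepth_eq_of_subtreeSize hc
      (by have := hcb.subtreeSize_le; omega)
    have := p.totalDist_le_of_heavy hcb hb
    exact ⟨_, haw.nodeDepth_le, hmax _ ha, by omega⟩
  refine ⟨b, hb, le_antisymm ?_ ?_, hmax⟩
  · have hbc : p.IsCentroid b := by
      intro w
      obtain ⟨d, -, h1, h2⟩ := key w
      omega
    refine le_csInf ⟨_, b, hbc, rfl⟩ ?_
    rintro d ⟨w, hw, rfl⟩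
    obtain ⟨d, h0, h1, h2⟩ := key w
    have := hw b
    unfold nodeDepth at *
    omega
  · apply Nat.sInf_le
    refine ⟨b, ?_, rfl⟩
    intro w
    obtain ⟨d, -, h1, h2⟩ := key w
    omega

/-- With `n + 1` nodes, having more than `(n + 1) / 2` of them (rounded down) means having more than
half. -/
lemma le_centroidDepth_iff (p : ParentMap n) (h : ℕ) :
    h ≤ p.centroidDepth ↔ ∃ v, p.nodeDepth v = h ∧ (n + 1) / 2 < p.subtreeSize v := by
  obtain ⟨b, hb, hd, hmax⟩ := p.exists_deepest_heavy
  rw [← hd]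
  constructor
  · intro hh
    obtain ⟨a, ha, had⟩ := p.exists_ancestor_nodeDepth b hh
    have := ha.subtreeSize_le
    exact ⟨a, had, by omega⟩
  · rintro ⟨v, rfl, hv⟩
    exact hmax v (by omega)

open Classical in
/-- The number of nodes at depth `h` whose subtree has more than `m` nodes. -/
noncomputable def heavyCount (p : ParentMap n) (h m : ℕ) : ℕ :=
  (Finset.univ.filter fun v => p.nodeDepth v = h ∧ m < p.subtreeSize v).card

open Classical in
lemma heavyCount_half (p : ParentMap n) (h : ℕ) :
    p.heavyCount h ((n + 1) / 2) = if h ≤ p.centroidDepth then 1 else 0 := by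
  split_ifs with hh
  · obtain ⟨v, hv, hs⟩ := (p.le_centroidDepth_iff h).1 hh
    rw [heavyCount, Finset.card_eq_one]
    refine ⟨v, ?_⟩
    ext w
    simp only [Finset.mem_filter, Finset.mem_univ, true_and, Finset.mem_singleton]
    constructor
    · rintro ⟨hw, hws⟩
      exact p.eq_of_nodeDepth_eq_of_subtreeSize (hw.trans hv.symm) (by omega)
    · rintro rfl
      exact ⟨hv, hs⟩
  · rw [heavyCount, Finset.card_eq_zero, Finset.filter_eq_empty_iff]
    rintro v - hv
    exact hh ((p.le_centroidDepth_iff h).2 ⟨v, hv⟩)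

/-! ### Growing a tree by one node -/

lemma outDegree_eq_sum (p : ParentMap n) (v : Fin (n + 1)) :
    p.outDegree v = ∑ i, if p.parent i = v then 1 else 0 := by
  unfold outDegree children
  rw [Finset.card_filter, Fin.sum_univ_succ]
  simp [p.not_isParent_zero, p.isParent_succ]

lemma sum_mul_outDegree (p : ParentMap n) (g : Fin (n + 1) → ℝ) :
    ∑ u, g u * p.outDegree u = ∑ i, g (p.parent i) := by
  simp_rw [outDegree_eq_sum]
  push_cast
  simp_rw [Finset.mul_sum]
  rw [Finset.sum_comm]
  simp

lemma sum_outDegree (p : ParentMap n) : ∑ u, p.outDegree u = n := by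
  simp_rw [outDegree_eq_sum]
  rw [Finset.sum_comm]
  simp

/-- The tree obtained from `p` by attaching one more node, with the largest label, to `u`. -/
def grow (p : ParentMap n) (u : Fin (n + 1)) : ParentMap (n + 1) :=
  Fin.snoc (α := fun i : Fin (n + 1) => Fin (i.val + 1)) p u

lemma sum_grow {M : Type*} [AddCommMonoid M] (f : ParentMap (n + 1) → M) :
    ∑ p, f p = ∑ p : ParentMap n, ∑ u, f (p.grow u) := by
  rw [← (Fin.snocEquiv (fun i : Fin (n + 1) => Fin (i.val + 1))).sum_comp,
    Fintype.sum_prod_type_right]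
  rfl

lemma parent_grow_castSucc (p : ParentMap n) (u : Fin (n + 1)) (i : Fin n) :
    (p.grow u).parent i.castSucc = (p.parent i).castSucc := by
  apply Fin.ext
  have : p.grow u i.castSucc = p i :=
    Fin.snoc_castSucc (α := fun i : Fin (n + 1) => Fin (i.val + 1)) u p i
  simp [parent, this]

lemma parent_grow_last (p : ParentMap n) (u : Fin (n + 1)) :
    (p.grow u).parent (Fin.last n) = u.castSucc := by
  apply Fin.ext
  have : p.grow u (Fin.last n) = u :=
    Fin.snoc_last (α := fun i : Fin (n + 1) => Fin (i.val + 1)) u p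
  simp [parent, this]

lemma isAncestor_grow_castSucc (p : ParentMap n) (u a b : Fin (n + 1)) :
    (p.grow u).IsAncestor a.castSucc b.castSucc ↔ p.IsAncestor a b := by
  refine p.node_induction
    (P := fun b => (p.grow u).IsAncestor a.castSucc b.castSucc ↔ p.IsAncestor a b) ?_ ?_ b
  · rw [Fin.castSucc_zero, isAncestor_zero, isAncestor_zero, ← Fin.castSucc_zero,
      Fin.castSucc_inj]
  · intro i ih
    rw [← Fin.succ_castSucc, isAncestor_succ, parent_grow_castSucc, ih, isAncestor_succ,
      Fin.succ_castSucc, Fin.castSucc_inj]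

lemma isAncestor_grow_last (p : ParentMap n) (u a : Fin (n + 1)) :
    (p.grow u).IsAncestor a.castSucc (Fin.last (n + 1)) ↔ p.IsAncestor a u := by
  rw [← Fin.succ_last, isAncestor_succ, parent_grow_last, isAncestor_grow_castSucc, Fin.succ_last]
  simp [(Fin.castSucc_lt_last a).ne]

lemma not_isAncestor_grow_castSucc (p : ParentMap n) (u b : Fin (n + 1)) :
    ¬ (p.grow u).IsAncestor (Fin.last (n + 1)) b.castSucc :=
  fun h => absurd h.le (not_le.2 (Fin.castSucc_lt_last b))

lemma nodeDepth_grow_castSucc (p : ParentMap n) (u v : Fin (n + 1)) :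
    (p.grow u).nodeDepth v.castSucc = p.nodeDepth v := by
  refine p.node_induction
    (P := fun v => (p.grow u).nodeDepth v.castSucc = p.nodeDepth v) ?_ ?_ v
  · rw [Fin.castSucc_zero, nodeDepth_zero, nodeDepth_zero]
  · intro i ih
    rw [← Fin.succ_castSucc, nodeDepth_succ, parent_grow_castSucc, ih, nodeDepth_succ]

lemma nodeDepth_grow_last (p : ParentMap n) (u : Fin (n + 1)) :
    (p.grow u).nodeDepth (Fin.last (n + 1)) = p.nodeDepth u + 1 := by
  rw [← Fin.succ_last, nodeDepth_succ, parent_grow_last, nodeDepth_grow_castSucc]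

open Classical in
lemma subtreeSize_eq_sum (p : ParentMap n) (v : Fin (n + 1)) :
    p.subtreeSize v = ∑ w, if p.IsAncestor v w then 1 else 0 := by
  rw [subtreeSize, descendants, Finset.card_filter]

open Classical in
lemma subtreeSize_grow_castSucc (p : ParentMap n) (u v : Fin (n + 1)) :
    (p.grow u).subtreeSize v.castSucc =
      p.subtreeSize v + if p.IsAncestor v u then 1 else 0 := by
  rw [subtreeSize_eq_sum, Fin.sum_univ_castSucc, subtreeSize_eq_sum]
  simp only [isAncestor_grow_castSucc, isAncestor_grow_last]

lemma subtreeSize_grow_last (p : ParentMap n) (u : Fin (n + 1)) :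
    (p.grow u).subtreeSize (Fin.last (n + 1)) = 1 := by
  classical
  rw [subtreeSize_eq_sum, Fin.sum_univ_castSucc]
  simp [not_isAncestor_grow_castSucc, isAncestor_refl]

lemma outDegree_grow_castSucc (p : ParentMap n) (u v : Fin (n + 1)) :
    (p.grow u).outDegree v.castSucc = p.outDegree v + if u = v then 1 else 0 := by
  rw [outDegree_eq_sum, Fin.sum_univ_castSucc, outDegree_eq_sum]
  simp only [parent_grow_castSucc, parent_grow_last, Fin.castSucc_inj]

lemma outDegree_grow_last (p : ParentMap n) (u : Fin (n + 1)) :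
    (p.grow u).outDegree (Fin.last (n + 1)) = 0 := by
  rw [outDegree_eq_sum, Fin.sum_univ_castSucc]
  simp [parent_grow_castSucc, parent_grow_last, (Fin.castSucc_lt_last _).ne]

/-- The total weight of all plane orderings of the tree `p`. -/
noncomputable def shapeWeight (φ : ℕ → ℝ) (p : ParentMap n) : ℝ :=
  ∏ v, φ (p.outDegree v) * ((p.outDegree v).factorial : ℝ)

lemma shapeWeight_eq_mul (φ : ℕ → ℝ) (p : ParentMap n) (u : Fin (n + 1)) :
    shapeWeight φ p = (φ (p.outDegree u) * ((p.outDegree u).factorial : ℝ)) *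
      ∏ v ∈ Finset.univ.erase u, φ (p.outDegree v) * ((p.outDegree v).factorial : ℝ) :=
  (Finset.mul_prod_erase _ _ (Finset.mem_univ u)).symm

lemma shapeWeight_grow_eq_mul (φ : ℕ → ℝ) (p : ParentMap n) (u : Fin (n + 1)) :
    shapeWeight φ (p.grow u) =
      (φ 0 * (φ (p.outDegree u + 1) * ((p.outDegree u + 1).factorial : ℝ))) *
      ∏ v ∈ Finset.univ.erase u, φ (p.outDegree v) * ((p.outDegree v).factorial : ℝ) := by
  unfold shapeWeight
  rw [Fin.prod_univ_castSucc, outDegree_grow_last, ← Finset.mul_prod_erase _ _ (Finset.mem_univ u),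
    outDegree_grow_castSucc, if_pos rfl]
  have : ∀ v ∈ Finset.univ.erase u, φ ((p.grow u).outDegree v.castSucc) *
      (((p.grow u).outDegree v.castSucc).factorial : ℝ) =
      φ (p.outDegree v) * ((p.outDegree v).factorial : ℝ) := by
    intro v hv
    rw [outDegree_grow_castSucc, if_neg (Finset.ne_of_mem_erase hv).symm, add_zero]
  rw [Finset.prod_congr rfl this, Nat.factorial_zero]
  push_cast
  ring

lemma sum_mul_treeWeight (φ : ℕ → ℝ) (f : ParentMap n → ℝ) :
    ∑ T : PlaneIncreasingTree n, f T.1 * treeWeight φ T = ∑ p, f p * shapeWeight φ p := by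
  rw [Fintype.sum_sigma]
  refine Finset.sum_congr rfl fun p _ => ?_
  simp only [treeWeight]
  rw [Finset.sum_const, Finset.card_univ, Fintype.card_pi, nsmul_eq_mul]
  have : ∀ v, Fintype.card (Fin (p.outDegree v) ≃ {u // u ∈ p.children v}) =
      (p.outDegree v).factorial := by
    intro v
    rw [Fintype.card_equiv (Fintype.equivOfCardEq
      (by rw [Fintype.card_fin, Fintype.card_coe, outDegree])), Fintype.card_fin]
  simp_rw [this]
  rw [shapeWeight, Finset.prod_mul_distrib]
  push_cast
  ring

lemma totalWeight_eq_sum (φ : ℕ → ℝ) (n : ℕ) :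
    totalWeight φ n = ∑ p : ParentMap n, shapeWeight φ p := by
  simpa [totalWeight] using sum_mul_treeWeight φ (fun _ : ParentMap n => 1)

/-- The weight with which a new node is attached to `u`, for the parameter `α` and up to the
factor `c₁`: it is linear in the out-degree of `u`. -/
noncomputable def attachWeight (α : ℝ) (p : ParentMap n) (u : Fin (n + 1)) : ℝ :=
  α + p.outDegree u * (1 - α)

lemma sum_mul_attachWeight (α : ℝ) (p : ParentMap n) (g : Fin (n + 1) → ℝ) :
    ∑ u, g u * attachWeight α p u = α * ∑ u, g u + (1 - α) * ∑ i, g (p.parent i) := by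
  rw [← sum_mul_outDegree, Finset.mul_sum, Finset.mul_sum, ← Finset.sum_add_distrib]
  exact Finset.sum_congr rfl fun u _ => by rw [attachWeight]; ring

lemma sum_attachWeight (α : ℝ) (p : ParentMap n) : ∑ u, attachWeight α p u = n + α := by
  have := sum_mul_attachWeight α p (fun _ => 1)
  simp at this
  rw [this]
  ring

open Classical in
/-- A subtree with `s` nodes has `s - 1` edges, so it attracts a new node with total weight
`s α + (s - 1) (1 - α) = s - 1 + α`. -/
lemma sum_attachWeight_descendants (α : ℝ) (p : ParentMap n) (v : Fin (n + 1)) :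
    ∑ u, (if p.IsAncestor v u then 1 else 0) * attachWeight α p u =
      p.subtreeSize v - 1 + α := by
  rw [sum_mul_attachWeight]
  have h1 : ∑ u, (if p.IsAncestor v u then (1 : ℝ) else 0) = p.subtreeSize v := by
    rw [subtreeSize_eq_sum]
    push_cast
    rfl
  have h2 : ∑ i, (if p.IsAncestor v (p.parent i) then (1 : ℝ) else 0) = p.subtreeSize v - 1 := by
    have h3 : ∑ w, ((if p.IsAncestor v w then (1 : ℝ) else 0) - (if v = w then 1 else 0)) =
        ∑ i, (if p.IsAncestor v (p.parent i) then (1 : ℝ) else 0) := by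
      rw [Fin.sum_univ_succ]
      simp only [isAncestor_zero, sub_self, zero_add]
      refine Finset.sum_congr rfl fun i _ => ?_
      have : v = i.succ → ¬ p.IsAncestor v (p.parent i) := by
        rintro rfl
        exact p.not_isAncestor_parent i
      simp only [isAncestor_succ]
      split_ifs <;> simp_all
    rw [← h3, Finset.sum_sub_distrib, h1]
    simp
  rw [h1, h2]
  ring

end ParentMap

open ParentMap

/-- In a very simple family the degree weights satisfy a linear recursion: for `α ≠ 1` that of the
coefficients of `φ₀ (1 + c₁ (α - 1) t / φ₀) ^ (α / (α - 1))`. Assume the recursion below `d`. Then a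
tree with `d + 2` nodes has the weight predicted from the tree without its last node, unless this
node is attached to a node that already has all the other `d` nodes as its children. The latter
trees all deviate by the same amount, and the prescribed total weight forces it to be zero. -/
lemma IsVerySimple.weight_recursion {φ : ℕ → ℝ} {c₁ c₂ α : ℝ} (hφ : IsVerySimple φ c₁ c₂)
    (hα : α = 1 + c₂ / c₁) (d : ℕ) :
    φ 0 * (((d : ℝ) + 1) * φ (d + 1)) = c₁ * (α + d * (1 - α)) * φ d := by
  induction d using Nat.strong_induction_on with
  | _ n ih =>
  -- `e d` is the defect of the recursion at `d`; it vanishes for `d < n`.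
  set e : ℕ → ℝ := fun d => φ 0 * (((d : ℝ) + 1) * φ (d + 1)) - c₁ * (α + d * (1 - α)) * φ d
    with he
  have hc : c₂ = c₁ * (α - 1) := by
    have := hφ.c₁_pos.ne'
    rw [hα]
    field_simp
    ring
  have hterm : ∀ (p : ParentMap n) (u : Fin (n + 1)),
      shapeWeight φ (p.grow u) - c₁ * (attachWeight α p u * shapeWeight φ p) =
        (if p.outDegree u = n then 1 else 0) * (e n * (n.factorial * φ 0 ^ n)) := by
    intro p u
    have h0 : shapeWeight φ (p.grow u) - c₁ * (attachWeight α p u * shapeWeight φ p) =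
        e (p.outDegree u) * ((p.outDegree u).factorial *
      ∏ v ∈ Finset.univ.erase u, φ (p.outDegree v) * ((p.outDegree v).factorial : ℝ)) := by
      rw [shapeWeight_grow_eq_mul, shapeWeight_eq_mul φ p u, attachWeight, he,
        Nat.factorial_succ]
      push_cast
      ring
    rw [h0]
    have hsum := p.sum_outDegree
    rw [← Finset.add_sum_erase _ _ (Finset.mem_univ u)] at hsum
    split_ifs with hu
    · -- The out-degrees add up to `n`, so all nodes other than `u` are leaves.
      rw [hu] at hsum ⊢
      have hz : ∀ v ∈ Finset.univ.erase u, p.outDegree v = 0 :=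
        Finset.sum_eq_zero_iff.1 (by omega)
      rw [Finset.prod_congr rfl (fun v hv => by rw [hz v hv]), Finset.prod_const,
        Finset.card_erase_of_mem (Finset.mem_univ u)]
      simp
    · have hlt : p.outDegree u < n := by omega
      rw [he]
      simp only
      rw [ih _ hlt]
      ring
  have hdiff : ∑ p : ParentMap n, ∑ u, (shapeWeight φ (p.grow u) -
      c₁ * (attachWeight α p u * shapeWeight φ p)) = 0 := by
    simp_rw [Finset.sum_sub_distrib, ← Finset.mul_sum, ← Finset.sum_mul, sum_attachWeight]
    rw [← sum_grow, ← totalWeight_eq_sum, ← Finset.mul_sum, ← totalWeight_eq_sum, hφ.ratio, hc]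
    ring
  simp_rw [hterm, ← Finset.sum_mul] at hdiff
  -- The star, in which the root is the parent of all other nodes, makes the sum positive.
  have hpos : 0 < ∑ p : ParentMap n, ∑ u, (if p.outDegree u = n then (1 : ℝ) else 0) := by
    refine Finset.sum_pos' (fun p _ => Finset.sum_nonneg fun u _ => by positivity)
      ⟨fun _ => 0, Finset.mem_univ _, ?_⟩
    refine Finset.sum_pos' (fun u _ => by positivity) ⟨0, Finset.mem_univ _, ?_⟩
    have : ParentMap.outDegree (n := n) (fun _ => 0) 0 = n := by
      rw [outDegree_eq_sum]
      simp [parent]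
    rw [if_pos this]
    exact one_pos
  have hf : (0 : ℝ) < n.factorial * φ 0 ^ n :=
    mul_pos (by exact_mod_cast n.factorial_pos) (pow_pos hφ.leaf_pos n)
  have := (mul_eq_zero.1 hdiff).resolve_left hpos.ne'
  have := (mul_eq_zero.1 this).resolve_right hf.ne'
  rw [he] at this
  simp only at this
  linarith

/-- A very simple family is generated by successively attaching nodes, at each node with a
weight that is linear in its out-degree. -/
lemma IsVerySimple.shapeWeight_grow {φ : ℕ → ℝ} {c₁ c₂ α : ℝ} (hφ : IsVerySimple φ c₁ c₂)
    (hα : α = 1 + c₂ / c₁) {n : ℕ} (p : ParentMap n) (u : Fin (n + 1)) :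
    shapeWeight φ (p.grow u) = c₁ * attachWeight α p u * shapeWeight φ p := by
  have h := hφ.weight_recursion hα (p.outDegree u)
  rw [shapeWeight_grow_eq_mul, shapeWeight_eq_mul φ p u, attachWeight, Nat.factorial_succ]
  push_cast
  rw [mul_assoc c₁, ← mul_assoc c₁, ← mul_assoc (c₁ * _), ← mul_assoc (c₁ * _), ← h]
  ring

lemma IsVerySimple.sum_shapeWeight_succ {φ : ℕ → ℝ} {c₁ c₂ α : ℝ} (hφ : IsVerySimple φ c₁ c₂)
    (hα : α = 1 + c₂ / c₁) {n : ℕ} (f : ParentMap (n + 1) → ℝ) :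
    ∑ p, f p * shapeWeight φ p =
      c₁ * ∑ p : ParentMap n, (∑ u, f (p.grow u) * attachWeight α p u) * shapeWeight φ p := by
  rw [sum_grow, Finset.mul_sum]
  refine Finset.sum_congr rfl fun p _ => ?_
  rw [Finset.sum_mul, Finset.mul_sum]
  refine Finset.sum_congr rfl fun u _ => ?_
  rw [hφ.shapeWeight_grow hα]
  ring

/-! ### The expected number of large subtrees at a given depth -/

/-- The sum over all trees with `n + 1` nodes of their weight times the number of nodes at depth
`h` whose subtree has more than `m` nodes. -/
noncomputable def heavyWeight (φ : ℕ → ℝ) (h n m : ℕ) : ℝ :=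
  ∑ p : ParentMap n, (p.heavyCount h m : ℝ) * shapeWeight φ p

namespace ParentMap

variable {n : ℕ}

open Classical in
lemma heavyCount_eq_sum (p : ParentMap n) (h m : ℕ) :
    (p.heavyCount h m : ℝ) =
      ∑ v, if p.nodeDepth v = h then (if m < p.subtreeSize v then 1 else 0) else 0 := by
  rw [heavyCount, Finset.card_filter]
  push_cast
  exact Finset.sum_congr rfl fun v _ => by split_ifs <;> simp_all

/-- Attaching a node to a subtree of size `s` has total weight `s - 1 + α`, so this is the weight
with which a subtree of size `m + 1` becomes one of size `m + 2`. -/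
lemma sum_heavyCount_grow_succ (α : ℝ) (p : ParentMap n) (h m : ℕ) :
    ∑ u, ((p.grow u).heavyCount h (m + 1) : ℝ) * attachWeight α p u =
      ((n : ℝ) - m) * p.heavyCount h (m + 1) + (m + α) * p.heavyCount h m := by
  classical
  have hgrow : ∀ u, ((p.grow u).heavyCount h (m + 1) : ℝ) = ∑ v, if p.nodeDepth v = h then
      (if m + 1 < p.subtreeSize v + (if p.IsAncestor v u then 1 else 0) then 1 else 0) else 0 := by
    intro u
    rw [heavyCount_eq_sum, Fin.sum_univ_castSucc, subtreeSize_grow_last,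
      if_neg (show ¬ m + 1 < 1 by omega), ite_self, add_zero]
    simp_rw [nodeDepth_grow_castSucc, subtreeSize_grow_castSucc]
  simp_rw [hgrow, heavyCount_eq_sum, Finset.sum_mul]
  rw [Finset.sum_comm, Finset.mul_sum, Finset.mul_sum, ← Finset.sum_add_distrib]
  refine Finset.sum_congr rfl fun v _ => ?_
  by_cases hd : p.nodeDepth v = h
  · simp only [hd, if_true]
    rcases lt_trichotomy (p.subtreeSize v) (m + 1) with hs | hs | hs
    · rw [Finset.sum_eq_zero, if_neg (by omega), if_neg (by omega)]
      · ring
      · intro u _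
        rw [if_neg (by split_ifs <;> omega), zero_mul]
    · have : ∀ u, (if m + 1 < p.subtreeSize v + (if p.IsAncestor v u then 1 else 0)
          then (1 : ℝ) else 0) = if p.IsAncestor v u then 1 else 0 := by
        intro u
        rw [hs]
        split_ifs <;> simp_all
      simp_rw [this]
      rw [sum_attachWeight_descendants, hs, if_neg (by omega), if_pos (by omega)]
      push_cast
      ring
    · have : ∀ u, (if m + 1 < p.subtreeSize v + (if p.IsAncestor v u then 1 else 0)
          then (1 : ℝ) else 0) = 1 := fun u => if_pos (by omega)
      simp_rw [this, one_mul]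
      rw [sum_attachWeight, if_pos hs, if_pos (by omega)]
      ring
  · simp [hd]

/-- Besides the old nodes at depth `h + 1` there is a new one whenever the new node is attached
to a node at depth `h`. -/
lemma sum_heavyCount_grow_zero (α : ℝ) (p : ParentMap n) (h : ℕ) :
    ∑ u, ((p.grow u).heavyCount (h + 1) 0 : ℝ) * attachWeight α p u =
      ((n : ℝ) + 1) * p.heavyCount (h + 1) 0 + α * p.heavyCount h 0 := by
  classical
  have hcount : ∀ k, (p.heavyCount k 0 : ℝ) = ∑ v, if p.nodeDepth v = k then (1 : ℝ) else 0 := by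
    intro k
    simp [heavyCount_eq_sum, p.subtreeSize_pos]
  have hgrow : ∀ u, ((p.grow u).heavyCount (h + 1) 0 : ℝ) =
      p.heavyCount (h + 1) 0 + if p.nodeDepth u = h then 1 else 0 := by
    intro u
    rw [hcount, heavyCount_eq_sum, Fin.sum_univ_castSucc]
    simp [nodeDepth_grow_castSucc, nodeDepth_grow_last, subtreeSize_pos]
  have hpar : ∑ i, (if p.nodeDepth (p.parent i) = h then (1 : ℝ) else 0) =
      p.heavyCount (h + 1) 0 := by
    rw [hcount, Fin.sum_univ_succ]
    simp [nodeDepth_succ]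
  simp_rw [hgrow, add_mul]
  rw [Finset.sum_add_distrib, ← Finset.mul_sum, sum_attachWeight, sum_mul_attachWeight, hpar,
    ← hcount h]
  ring

lemma heavyCount_zero (p : ParentMap n) (m : ℕ) :
    p.heavyCount 0 m = if m ≤ n then 1 else 0 := by
  rw [heavyCount, Finset.card_filter]
  simp_rw [nodeDepth_eq_zero, ite_and]
  simp [subtreeSize_zero]

lemma heavyCount_succ_of_le (p : ParentMap n) (h : ℕ) {m : ℕ} (hm : n ≤ m) :
    p.heavyCount (h + 1) m = 0 := by
  rw [heavyCount, Finset.card_eq_zero, Finset.filter_eq_empty_iff]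
  rintro v - ⟨hd, hs⟩
  cases v using Fin.cases with
  | zero => simp at hd
  | succ i =>
    have := p.subtreeSize_succ_le i
    omega

end ParentMap

lemma heavyWeight_zero (φ : ℕ → ℝ) (n m : ℕ) :
    heavyWeight φ 0 n m = if m ≤ n then totalWeight φ n else 0 := by
  rw [totalWeight_eq_sum]
  simp only [heavyWeight, heavyCount_zero]
  split_ifs <;> simp

lemma heavyWeight_succ_of_le (φ : ℕ → ℝ) (h : ℕ) {n m : ℕ} (hm : n ≤ m) :
    heavyWeight φ (h + 1) n m = 0 := by
  simp [heavyWeight, heavyCount_succ_of_le _ _ hm]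

section VerySimple

variable {φ : ℕ → ℝ} {c₁ c₂ α : ℝ}

lemma IsVerySimple.totalWeight_succ (hφ : IsVerySimple φ c₁ c₂) (hα : α = 1 + c₂ / c₁) (n : ℕ) :
    totalWeight φ (n + 1) = c₁ * (n + α) * totalWeight φ n := by
  have := hφ.c₁_pos.ne'
  rw [hφ.ratio, hα]
  field_simp
  ring

lemma IsVerySimple.heavyWeight_grow_succ (hφ : IsVerySimple φ c₁ c₂) (hα : α = 1 + c₂ / c₁)
    (h n m : ℕ) :
    heavyWeight φ h (n + 1) (m + 1) =
      c₁ * (((n : ℝ) - m) * heavyWeight φ h n (m + 1) + (m + α) * heavyWeight φ h n m) := by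
  unfold heavyWeight
  rw [hφ.sum_shapeWeight_succ hα, Finset.mul_sum _ _ ((n : ℝ) - m), Finset.mul_sum _ _ (m + α),
    ← Finset.sum_add_distrib]
  congr 1
  refine Finset.sum_congr rfl fun p _ => ?_
  rw [sum_heavyCount_grow_succ]
  ring

lemma IsVerySimple.heavyWeight_grow_zero (hφ : IsVerySimple φ c₁ c₂) (hα : α = 1 + c₂ / c₁)
    (h n : ℕ) :
    heavyWeight φ (h + 1) (n + 1) 0 =
      c₁ * (((n : ℝ) + 1) * heavyWeight φ (h + 1) n 0 + α * heavyWeight φ h n 0) := by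
  unfold heavyWeight
  rw [hφ.sum_shapeWeight_succ hα, Finset.mul_sum _ _ ((n : ℝ) + 1), Finset.mul_sum _ _ α,
    ← Finset.sum_add_distrib]
  congr 1
  refine Finset.sum_congr rfl fun p _ => ?_
  rw [sum_heavyCount_grow_zero]
  ring

/-- A relation between different subtree sizes for a fixed tree size. The growth recursions carry it
from the tree size `n` to `n + 1`. -/
lemma IsVerySimple.heavyWeight_threshold (hφ : IsVerySimple φ c₁ c₂) (hα : α = 1 + c₂ / c₁)
    (h n m : ℕ) :
    (m + α) * heavyWeight φ (h + 1) n m =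
      (m + 1) * heavyWeight φ (h + 1) n (m + 1) + α * heavyWeight φ h n (m + 1) := by
  induction n generalizing m with
  | zero =>
    have h0 : heavyWeight φ h 0 (m + 1) = 0 := by
      cases h with
      | zero => simp [heavyWeight_zero]
      | succ h => exact heavyWeight_succ_of_le _ _ (by omega)
    rw [heavyWeight_succ_of_le _ _ (by omega), heavyWeight_succ_of_le _ _ (by omega), h0]
    ring
  | succ n ih =>
    rw [hφ.heavyWeight_grow_succ hα (h + 1) n m, hφ.heavyWeight_grow_succ hα h n m]
    have e1 := ih m
    cases m with
    | zero =>
      rw [hφ.heavyWeight_grow_zero hα]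
      push_cast at *
      linear_combination (c₁ * n) * e1
    | succ m =>
      rw [hφ.heavyWeight_grow_succ hα (h + 1) n m]
      have e2 := ih m
      push_cast at *
      linear_combination (c₁ * (m + 1 + α)) * e2 + c₁ * ((n : ℝ) - (m + 1)) * e1

lemma IsVerySimple.heavyWeight_succ (hφ : IsVerySimple φ c₁ c₂) (hα : α = 1 + c₂ / c₁)
    (h n m : ℕ) :
    heavyWeight φ (h + 1) (n + 1) m =
      c₁ * (((n : ℝ) + 1) * heavyWeight φ (h + 1) n m + α * heavyWeight φ h n m) := by
  cases m with
  | zero => exact hφ.heavyWeight_grow_zero hα h n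
  | succ m =>
    rw [hφ.heavyWeight_grow_succ hα, hφ.heavyWeight_threshold hα]
    ring

end VerySimple

/-! ### The limit of the tails -/

/-- `G n m` is close to `Ψ (n / m)`, uniformly for `m ≤ n ≤ 2 m` as `m → ∞`. -/
def UniformApprox (G : ℕ → ℕ → ℝ) (Ψ : ℝ → ℝ) : Prop :=
  ∀ ε > 0, ∀ᶠ m : ℕ in atTop, ∀ n, m ≤ n → n ≤ 2 * m → |G n m - Ψ ((n : ℝ) / m)| ≤ ε

lemma ContinuousOn.exists_dist_lt_on_Icc {F : ℝ → ℝ} (hF : ContinuousOn F (Set.Icc 1 2)) {η : ℝ}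
    (hη : 0 < η) : ∃ δ > 0, ∀ x ∈ Set.Icc (1 : ℝ) 2, ∀ y ∈ Set.Icc (1 : ℝ) 2, |x - y| < δ →
      |F x - F y| < η := by
  have h := isCompact_Icc.uniformContinuousOn_of_continuous hF
  rw [Metric.uniformContinuousOn_iff] at h
  obtain ⟨δ, hδ, h⟩ := h η hη
  exact ⟨δ, hδ, fun x hx y hy hxy => h x hx y hy hxy⟩

/-- A recursion with step `α / (n + 1)` is a Riemann sum of step `1 / m` for the differential
equation `Ψ' = α Ψ₀ / x`. -/
lemma UniformApprox.step {α : ℝ} (hα : 0 < α) {G G' : ℕ → ℕ → ℝ} {Ψ Ψ' : ℝ → ℝ}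
    (hG : UniformApprox G Ψ) (hΨ : ContinuousOn Ψ (Set.Icc 1 2))
    (hstart : ∀ m, G' m m = 0) (hΨ1 : Ψ' 1 = 0)
    (hrec : ∀ n m, m ≤ n → G' (n + 1) m = G' n m + α / (n + 1) * G n m)
    (hderiv : ∀ x, 0 < x → HasDerivAt Ψ' (α * Ψ x / x) x) : UniformApprox G' Ψ' := by
  intro ε hε
  set η : ℝ := ε / (3 * α) with hη
  have hη0 : 0 < η := by positivity
  have hF : ContinuousOn (fun x => Ψ x / x) (Set.Icc 1 2) :=
    hΨ.div continuousOn_id fun x hx => by linarith [hx.1]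
  obtain ⟨δ₁, hδ₁, h₁⟩ := hΨ.exists_dist_lt_on_Icc hη0
  obtain ⟨δ₂, hδ₂, h₂⟩ := hF.exists_dist_lt_on_Icc hη0
  have hev : ∀ᶠ m : ℕ in atTop, (1 : ℝ) / m < min δ₁ δ₂ :=
    tendsto_one_div_atTop_nhds_zero_nat.eventually_lt_const (lt_min hδ₁ hδ₂)
  filter_upwards [hG η hη0, hev, eventually_gt_atTop 0] with m hm hmδ hm0 n hmn
  have hm0' : (0 : ℝ) < m := by exact_mod_cast hm0
  have key : n ≤ 2 * m → |G' n m - Ψ' ((n : ℝ) / m)| ≤ ((n : ℝ) - m) / m * ε := by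
    induction n, hmn using Nat.le_induction with
    | base =>
      intro _
      rw [hstart, div_self hm0'.ne', hΨ1]
      simp
    | succ n hmn ih =>
      intro hn
      have ih := ih (by omega)
      have hmn' : (m : ℝ) ≤ n := by exact_mod_cast hmn
      have hn' : (n : ℝ) + 1 ≤ 2 * m := by exact_mod_cast hn
      set x₀ : ℝ := (n : ℝ) / m with hx₀
      set x₁ : ℝ := ((n : ℝ) + 1) / m with hx₁
      have hdiff : x₁ - x₀ = 1 / m := by rw [hx₀, hx₁]; ring
      have hpos : (0 : ℝ) < 1 / m := by positivity
      have hx₀1 : 1 ≤ x₀ := by rw [hx₀, le_div_iff₀ hm0']; linarith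
      have hx₁2 : x₁ ≤ 2 := by rw [hx₁, div_le_iff₀ hm0']; linarith
      have hlt : x₀ < x₁ := by linarith
      obtain ⟨ξ, hξ, hmvt⟩ := exists_hasDerivAt_eq_slope Ψ' (fun x => α * Ψ x / x) hlt
        (fun x hx => (hderiv x (by linarith [hx.1])).continuousAt.continuousWithinAt)
        (fun x hx => hderiv x (by linarith [hx.1]))
      have hx₀I : x₀ ∈ Set.Icc (1 : ℝ) 2 := ⟨hx₀1, by linarith⟩
      have hx₁I : x₁ ∈ Set.Icc (1 : ℝ) 2 := ⟨by linarith, hx₁2⟩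
      have hξI : ξ ∈ Set.Icc (1 : ℝ) 2 := ⟨by linarith [hξ.1], by linarith [hξ.2]⟩
      have hb := lt_min_iff.1 hmδ
      have e1 : |Ψ ξ / ξ - Ψ x₁ / x₁| < η := h₂ ξ hξI x₁ hx₁I (by
        rw [abs_sub_lt_iff]; constructor <;> linarith [hξ.1, hξ.2, hb.2])
      have e2 : |Ψ x₁ - Ψ x₀| < η := h₁ x₁ hx₁I x₀ hx₀I (by
        rw [hdiff, abs_of_pos hpos]; exact hb.1)
      have e3 : |Ψ x₀ - G n m| ≤ η := by
        rw [abs_sub_comm]; exact hm n hmn (by omega)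
      have hx₁0 : 0 < x₁ := by linarith
      -- Both increments are `1 / m` times a value that is close to `α * Ψ x₁ / x₁`.
      have hinc : Ψ' x₁ - Ψ' x₀ = 1 / m * (α * (Ψ ξ / ξ)) := by
        rw [hdiff, eq_div_iff hpos.ne'] at hmvt
        rw [← hmvt]
        ring
      have hstep : α / ((n : ℝ) + 1) * G n m = 1 / m * (α * (G n m / x₁)) := by
        rw [hx₁]
        have : (n : ℝ) + 1 ≠ 0 := by positivity
        field_simp
      have hdiv : ∀ a, |a| ≤ η → |a / x₁| ≤ η := by
        intro a ha
        rw [abs_div, abs_of_pos hx₁0]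
        exact (div_le_self (abs_nonneg a) (by linarith)).trans ha
      have hbound : |Ψ ξ / ξ - G n m / x₁| ≤ 3 * η := by
        have : Ψ ξ / ξ - G n m / x₁ = (Ψ ξ / ξ - Ψ x₁ / x₁) + (Ψ x₁ - Ψ x₀) / x₁ +
            (Ψ x₀ - G n m) / x₁ := by ring
        rw [this]
        refine (abs_add_three _ _ _).trans ?_
        linarith [hdiv _ e2.le, hdiv _ e3]
      have hlast : |1 / m * (α * (Ψ ξ / ξ)) - 1 / m * (α * (G n m / x₁))| ≤ 1 / m * ε := by
        rw [← mul_sub, ← mul_sub, abs_mul, abs_mul, abs_of_pos hpos, abs_of_pos hα]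
        refine mul_le_mul_of_nonneg_left ?_ hpos.le
        calc α * |Ψ ξ / ξ - G n m / x₁| ≤ α * (3 * η) :=
              mul_le_mul_of_nonneg_left hbound hα.le
          _ = ε := by rw [hη]; field_simp
      rw [← hinc, ← hstep] at hlast
      push_cast
      rw [hrec n m hmn, ← hx₁]
      have hsplit : G' n m + α / ((n : ℝ) + 1) * G n m - Ψ' x₁ =
          (G' n m - Ψ' x₀) - (Ψ' x₁ - Ψ' x₀ - α / ((n : ℝ) + 1) * G n m) := by ring
      rw [hsplit]
      refine (abs_sub _ _).trans ?_
      have : ((n : ℝ) + 1 - m) / m * ε = ((n : ℝ) - m) / m * ε + 1 / m * ε := by ring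
      rw [this]
      exact add_le_add ih hlast
  intro hn
  refine (key hn).trans ?_
  have hn' : (n : ℝ) ≤ 2 * m := by exact_mod_cast hn
  have : ((n : ℝ) - m) / m ≤ 1 := by
    rw [div_le_one hm0']
    linarith
  exact (mul_le_mul_of_nonneg_right this hε.le).trans (one_mul ε).le

/-- Euler's limit formula for the Gamma function, for a sequence given by its ratios. -/
lemma tendsto_div_rpow_of_ratio {α : ℝ} (hα : 0 < α) {b : ℕ → ℝ}
    (hb : ∀ n : ℕ, ((n : ℝ) + 1) * b (n + 1) = (n + α) * b n) :
    Tendsto (fun n : ℕ => b n / (n : ℝ) ^ (α - 1)) atTop (𝓝 (b 0 / Real.Gamma α)) := by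
  have hprod : ∀ n : ℕ, b n * n.factorial = b 0 * ∏ j ∈ Finset.range n, (α + j) := by
    intro n
    induction n with
    | zero => simp
    | succ n ih =>
      rw [Finset.prod_range_succ, ← mul_assoc, ← ih, Nat.factorial_succ]
      push_cast
      linear_combination (n.factorial : ℝ) * hb n
  have h1 : Tendsto (fun n : ℕ => (n : ℝ) / (n + α)) atTop (𝓝 1) :=
    tendsto_natCast_div_add_atTop α
  have h2 := ((tendsto_const_nhds (x := b 0)).mul h1).div (Real.GammaSeq_tendsto_Gamma α)
    (Real.Gamma_pos_of_pos hα).ne'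
  rw [mul_one] at h2
  refine h2.congr' ?_
  filter_upwards [eventually_gt_atTop 0] with n hn
  have hn' : (0 : ℝ) < n := by exact_mod_cast hn
  have hP : (0 : ℝ) < ∏ j ∈ Finset.range n, (α + j) :=
    Finset.prod_pos fun j _ => by positivity
  have hf : (0 : ℝ) < n.factorial := by exact_mod_cast n.factorial_pos
  have hbn : b n = b 0 * (∏ j ∈ Finset.range n, (α + j)) / n.factorial := by
    rw [← hprod, mul_div_cancel_right₀ _ hf.ne']
  rw [Pi.div_apply, Real.GammaSeq, Finset.prod_range_succ, hbn, Real.rpow_sub_one hn'.ne']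
  have : 0 < (n : ℝ) ^ α := by positivity
  have : 0 < α + (n : ℝ) := by positivity
  rw [add_comm (n : ℝ) α]
  field_simp

/-- Such a sequence grows like `C * n ^ (α - 1)` with `C ≠ 0`, hence its ratios converge to the ratios
of the powers. -/
lemma uniformApprox_ratio {α : ℝ} (hα : 0 < α) {b : ℕ → ℝ} (hb0 : b 0 ≠ 0)
    (hb : ∀ n : ℕ, ((n : ℝ) + 1) * b (n + 1) = (n + α) * b n) :
    UniformApprox (fun n m => b n / b m) (fun x => x ^ (α - 1)) := by
  intro ε hε
  have hcont : ContinuousOn (fun x : ℝ => x ^ (α - 1)) (Set.Icc 1 2) :=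
    continuousOn_id.rpow_const fun x hx => Or.inl (by have := hx.1; simp; linarith)
  obtain ⟨M, hM⟩ := isCompact_Icc.exists_bound_of_continuousOn hcont
  have hlim := tendsto_div_rpow_of_ratio hα hb
  set C := b 0 / Real.Gamma α with hC
  have hC0 : C ≠ 0 := div_ne_zero hb0 (Real.Gamma_pos_of_pos hα).ne'
  have hpair : Tendsto (fun q : ℕ × ℕ => (b q.1 / (q.1 : ℝ) ^ (α - 1)) /
      (b q.2 / (q.2 : ℝ) ^ (α - 1))) (atTop ×ˢ atTop) (𝓝 (C / C)) :=
    (hlim.comp tendsto_fst).div (hlim.comp tendsto_snd) hC0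
  rw [div_self hC0, Metric.tendsto_nhds] at hpair
  have hM0 : 0 ≤ M := (norm_nonneg _).trans (hM 1 ⟨le_rfl, one_le_two⟩)
  have hev := hpair (ε / (M + 1)) (by positivity)
  rw [prod_atTop_atTop_eq, eventually_atTop] at hev
  obtain ⟨⟨a₁, a₂⟩, ha⟩ := hev
  filter_upwards [eventually_ge_atTop a₁, eventually_ge_atTop a₂, eventually_gt_atTop 0]
    with m h1 h2 hm n hmn hn
  have hm' : (0 : ℝ) < m := by exact_mod_cast hm
  have hmn' : (m : ℝ) ≤ n := by exact_mod_cast hmn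
  have hn' : (n : ℝ) ≤ 2 * m := by exact_mod_cast hn
  have hx : (n : ℝ) / m ∈ Set.Icc (1 : ℝ) 2 :=
    ⟨by rw [le_div_iff₀ hm']; linarith, by rw [div_le_iff₀ hm']; linarith⟩
  have hclose := ha (n, m) ⟨h1.trans hmn, h2⟩
  rw [Real.dist_eq] at hclose
  have hnpos : (0 : ℝ) < (n : ℝ) ^ (α - 1) := by
    have : (0 : ℝ) < n := by linarith
    positivity
  have hmpos : (0 : ℝ) < (m : ℝ) ^ (α - 1) := by positivity
  have hsplit : b n / b m - ((n : ℝ) / m) ^ (α - 1) =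
      (b n / (n : ℝ) ^ (α - 1) / (b m / (m : ℝ) ^ (α - 1)) - 1) * ((n : ℝ) / m) ^ (α - 1) := by
    rw [Real.div_rpow (by positivity) hm'.le]
    by_cases hbm : b m = 0
    · rw [hbm]; simp
    · field_simp
  rw [hsplit, abs_mul]
  calc _ ≤ ε / (M + 1) * M :=
        mul_le_mul hclose.le (hM _ hx) (abs_nonneg _) (by positivity)
    _ ≤ ε / (M + 1) * (M + 1) := by gcongr; linarith
    _ = ε := by field_simp

/-- `Ψ h` is the `h`-fold iterate of `f ↦ α ∫₁ˣ f(s) / s ds`, applied to `x ^ (α - 1)`. -/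
structure IsTailProfile (α : ℝ) (Ψ : ℕ → ℝ → ℝ) : Prop where
  zero : ∀ x, 0 < x → Ψ 0 x = x ^ (α - 1)
  start : ∀ h, Ψ (h + 1) 1 = 0
  deriv : ∀ h x, 0 < x → HasDerivAt (Ψ (h + 1)) (α * Ψ h x / x) x

lemma IsTailProfile.continuousOn {α : ℝ} {Ψ : ℕ → ℝ → ℝ} (hΨ : IsTailProfile α Ψ) (h : ℕ) :
    ContinuousOn (Ψ h) (Set.Ioi 0) := by
  cases h with
  | zero =>
    have : ContinuousOn (fun x : ℝ => x ^ (α - 1)) (Set.Ioi 0) :=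
      continuousOn_id.rpow_const fun x hx => Or.inl (ne_of_gt hx)
    exact this.congr fun x hx => hΨ.zero x hx
  | succ h => exact fun x hx => (hΨ.deriv h x hx).continuousAt.continuousWithinAt

section VerySimple

variable {φ : ℕ → ℝ} {c₁ c₂ α : ℝ}

lemma IsVerySimple.totalWeight_pos (hφ : IsVerySimple φ c₁ c₂) (n : ℕ) : 0 < totalWeight φ n := by
  induction n with
  | zero =>
    rw [totalWeight_eq_sum]
    refine Finset.sum_pos (fun p _ => Finset.prod_pos fun v _ => ?_) ⟨fun _ => 0, Finset.mem_univ _⟩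
    simpa [ParentMap.outDegree_eq_sum] using hφ.leaf_pos
  | succ n ih =>
    rw [hφ.totalWeight_succ rfl]
    have := hφ.c₁_pos
    have := hφ.alpha_pos
    positivity

/-- The normalisation by `c₁ ^ n * n!` turns the recursion for `heavyWeight` into a recursion for
increments; dividing by the value of the normalised total weight at `m` gives a finite limit. -/
lemma IsVerySimple.uniformApprox (hφ : IsVerySimple φ c₁ c₂) (hα : α = 1 + c₂ / c₁)
    {Ψ : ℕ → ℝ → ℝ} (hΨ : IsTailProfile α Ψ) (h : ℕ) :
    UniformApprox (fun n m => heavyWeight φ h n m / (c₁ ^ n * n.factorial) /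
      (totalWeight φ m / (c₁ ^ m * m.factorial))) (Ψ h) := by
  have hα0 : 0 < α := hα ▸ hφ.alpha_pos
  have hc := hφ.c₁_pos
  induction h with
  | zero =>
    have hb0 : totalWeight φ 0 / (c₁ ^ 0 * (Nat.factorial 0 : ℝ)) ≠ 0 := by
      simpa using (hφ.totalWeight_pos 0).ne'
    have hb := uniformApprox_ratio hα0 (b := fun n => totalWeight φ n / (c₁ ^ n * n.factorial))
      hb0 (fun n => by
        have : (0 : ℝ) < n.factorial := by exact_mod_cast n.factorial_pos
        rw [hφ.totalWeight_succ hα, Nat.factorial_succ]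
        push_cast
        field_simp
        ring)
    intro ε hε
    filter_upwards [hb ε hε, eventually_gt_atTop 0] with m hm hm0 n hmn hn
    have hpos : (0 : ℝ) < (n : ℝ) / m := by
      have h1 : (0 : ℝ) < m := by exact_mod_cast hm0
      have h2 : (0 : ℝ) < n := by exact_mod_cast hm0.trans_le hmn
      positivity
    rw [heavyWeight_zero, if_pos hmn, hΨ.zero _ hpos]
    exact hm n hmn hn
  | succ h ih =>
    refine ih.step hα0 ((hΨ.continuousOn h).mono fun x hx => ?_) ?_ (hΨ.start h) ?_ (hΨ.deriv h)
    · exact lt_of_lt_of_le one_pos hx.1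
    · intro m
      rw [heavyWeight_succ_of_le _ _ le_rfl]
      simp
    · intro n m _
      have : (0 : ℝ) < n.factorial := by exact_mod_cast n.factorial_pos
      rw [hφ.heavyWeight_succ hα, Nat.factorial_succ]
      push_cast
      field_simp
      ring

/-- The tail of the law of the depth is an expected number of nodes, as at most one node at depth
`h` has a subtree with more than half of the nodes. -/
lemma treeProb_le_depth (φ : ℕ → ℝ) (h n : ℕ) :
    treeProb φ n {T | h ≤ T.depth} = heavyWeight φ h n ((n + 1) / 2) / totalWeight φ n := by
  classical
  rw [treeProb, heavyWeight, ← sum_mul_treeWeight]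
  congr 1
  refine Finset.sum_congr rfl fun T _ => ?_
  rw [heavyCount_half, Set.indicator_apply]
  by_cases hT : h ≤ T.1.centroidDepth <;> simp [PlaneIncreasingTree.depth, hT]

lemma IsVerySimple.tendsto_treeProb_le_depth (hφ : IsVerySimple φ c₁ c₂) (hα : α = 1 + c₂ / c₁)
    {Ψ : ℕ → ℝ → ℝ} (hΨ : IsTailProfile α Ψ) (h : ℕ) :
    Tendsto (fun n : ℕ => treeProb φ n {T | h ≤ T.depth}) atTop
      (𝓝 (Ψ h 2 / (2 : ℝ) ^ (α - 1))) := by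
  have hhalf : Tendsto (fun n : ℕ => (n + 1) / 2) atTop atTop :=
    (Nat.tendsto_div_const_atTop two_ne_zero).comp (tendsto_add_atTop_nat 1)
  have hquot : Tendsto (fun n : ℕ => (n : ℝ) / ((n + 1) / 2 : ℕ)) atTop (𝓝 2) := by
    have hinv : Tendsto (fun n : ℕ => (2 : ℝ) - 1 / ((n + 1) / 2 : ℕ)) atTop (𝓝 (2 - 0)) :=
      tendsto_const_nhds.sub (tendsto_one_div_atTop_nhds_zero_nat.comp hhalf)
    rw [sub_zero] at hinv
    refine tendsto_of_tendsto_of_tendsto_of_le_of_le' hinv tendsto_const_nhds ?_ ?_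
    · filter_upwards [hhalf.eventually_gt_atTop 0] with n hn
      have hn' : (0 : ℝ) < ((n + 1) / 2 : ℕ) := by exact_mod_cast hn
      have h2 : 2 * ((n + 1) / 2 : ℕ) ≤ n + 1 := by omega
      have h2' : 2 * (((n + 1) / 2 : ℕ) : ℝ) ≤ n + 1 := by exact_mod_cast h2
      rw [le_div_iff₀ hn', sub_mul, one_div, inv_mul_cancel₀ hn'.ne']
      linarith
    · filter_upwards [hhalf.eventually_gt_atTop 0] with n hn
      have hn' : (0 : ℝ) < ((n + 1) / 2 : ℕ) := by exact_mod_cast hn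
      have h2 : n ≤ 2 * ((n + 1) / 2 : ℕ) := by omega
      rw [div_le_iff₀ hn']
      exact_mod_cast h2
  have key : ∀ k, Tendsto (fun n : ℕ => heavyWeight φ k n ((n + 1) / 2) /
      (c₁ ^ n * n.factorial) / (totalWeight φ ((n + 1) / 2) /
        (c₁ ^ ((n + 1) / 2) * ((n + 1) / 2).factorial))) atTop (𝓝 (Ψ k 2)) := by
    intro k
    have h1 : Tendsto (fun n : ℕ => Ψ k ((n : ℝ) / ((n + 1) / 2 : ℕ))) atTop (𝓝 (Ψ k 2)) :=
      ((hΨ.continuousOn k).continuousAt (Ioi_mem_nhds two_pos)).tendsto.comp hquot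
    refine tendsto_of_tendsto_of_dist h1 ?_
    rw [Metric.tendsto_nhds]
    intro ε hε
    filter_upwards [hhalf.eventually (hφ.uniformApprox hα hΨ k (ε / 2) (half_pos hε))] with n hn
    have := hn n (by omega) (by omega)
    rw [dist_zero_right, Real.norm_of_nonneg dist_nonneg, dist_comm, Real.dist_eq]
    linarith
  -- The normalisation in `m` cancels in the quotient of the quantities for `h` and for `0`.
  have h2 : Ψ 0 2 = (2 : ℝ) ^ (α - 1) := hΨ.zero 2 two_pos
  have hne : Ψ 0 2 ≠ 0 := by rw [h2]; positivity
  rw [← h2]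
  refine ((key h).div (key 0) hne).congr fun n => ?_
  have hc := hφ.c₁_pos
  have := hφ.totalWeight_pos n
  have := hφ.totalWeight_pos ((n + 1) / 2)
  have : (0 : ℝ) < n.factorial := by exact_mod_cast n.factorial_pos
  have : (0 : ℝ) < ((n + 1) / 2).factorial := by exact_mod_cast ((n + 1) / 2).factorial_pos
  rw [treeProb_le_depth, Pi.div_apply, heavyWeight_zero, if_pos (by omega)]
  field_simp

end VerySimple

/-! ### The explicit form of the limit -/

/-- The remainder of the exponential series after the terms of degree less than `h`. -/
noncomputable def expRemainder (h : ℕ) (t : ℝ) : ℝ :=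
  Real.exp t - ∑ j ∈ Finset.range h, t ^ j / (j.factorial : ℝ)

lemma hasDerivAt_pow_succ_div_factorial (j : ℕ) (t : ℝ) :
    HasDerivAt (fun t : ℝ => t ^ (j + 1) / ((j + 1).factorial : ℝ)) (t ^ j / (j.factorial : ℝ)) t := by
  refine ((hasDerivAt_pow (j + 1) t).div_const ((j + 1).factorial : ℝ)).congr_deriv ?_
  have : (j.factorial : ℝ) ≠ 0 := by exact_mod_cast j.factorial_ne_zero
  rw [Nat.factorial_succ]
  push_cast
  field_simp

lemma hasDerivAt_expRemainder (h : ℕ) (t : ℝ) :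
    HasDerivAt (expRemainder (h + 1)) (expRemainder h t) t := by
  have hsum : HasDerivAt (fun t : ℝ => ∑ j ∈ Finset.range h, t ^ (j + 1) / ((j + 1).factorial : ℝ))
      (∑ j ∈ Finset.range h, t ^ j / (j.factorial : ℝ)) t :=
    HasDerivAt.fun_sum fun j _ => hasDerivAt_pow_succ_div_factorial j t
  have heq : expRemainder (h + 1) = fun t => Real.exp t -
      ((∑ j ∈ Finset.range h, t ^ (j + 1) / ((j + 1).factorial : ℝ)) + 1) := by
    funext t
    rw [expRemainder, Finset.sum_range_succ']
    simp
  rw [heq]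
  exact (Real.hasDerivAt_exp t).sub (hsum.add_const 1)

lemma expRemainder_succ_zero (h : ℕ) : expRemainder (h + 1) 0 = 0 := by
  rw [expRemainder, Finset.sum_range_succ']
  simp

lemma tendsto_pow_mul_expRemainder (r t : ℝ) :
    Tendsto (fun h => r ^ h * expRemainder h t) atTop (𝓝 0) := by
  have hlim : Tendsto (fun h : ℕ => (|r| * |t|) ^ h / (h.factorial : ℝ) * 2) atTop (𝓝 0) := by
    simpa using (FloorSemiring.tendsto_pow_div_factorial_atTop (|r| * |t|)).mul_const 2
  -- The bound for the remainder needs `|t| / (h + 1) ≤ 1 / 2`.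
  refine squeeze_zero_norm' ?_ hlim
  filter_upwards [eventually_ge_atTop ⌈2 * |t|⌉₊] with h hh
  have hh' : 2 * |t| ≤ h := Nat.ceil_le.1 hh
  have hb : ‖(t : ℂ)‖ / h.succ ≤ 1 / 2 := by
    rw [Complex.norm_real, Real.norm_eq_abs, div_le_iff₀ (by positivity)]
    push_cast
    linarith
  have hexp := Complex.exp_bound' hb
  have hcast : Complex.exp t - ∑ m ∈ Finset.range h, (t : ℂ) ^ m / m.factorial =
      ((expRemainder h t : ℝ) : ℂ) := by
    rw [expRemainder]
    push_cast
    rfl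
  rw [hcast, Complex.norm_real, Complex.norm_real, Real.norm_eq_abs, Real.norm_eq_abs] at hexp
  rw [Real.norm_eq_abs, abs_mul, abs_pow, mul_pow]
  calc |r| ^ h * |expRemainder h t| ≤ |r| ^ h * (|t| ^ h / h.factorial * 2) := by gcongr
    _ = _ := by ring

/-- The explicit solution of the iterated differential equations of `IsTailProfile`. -/
noncomputable def tailProfile (α : ℝ) (h : ℕ) (x : ℝ) : ℝ :=
  if α = 1 then Real.log x ^ h / (h.factorial : ℝ)
  else (α / (α - 1)) ^ h * expRemainder h ((α - 1) * Real.log x)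

lemma isTailProfile_tailProfile (α : ℝ) : IsTailProfile α (tailProfile α) where
  zero x hx := by
    unfold tailProfile
    split_ifs with hα
    · simp [hα]
    · rw [Real.rpow_def_of_pos hx, mul_comm (Real.log x)]
      simp [expRemainder]
  start h := by
    unfold tailProfile
    split_ifs with hα
    · simp
    · rw [Real.log_one, mul_zero, expRemainder_succ_zero, mul_zero]
  deriv h x hx := by
    unfold tailProfile
    by_cases hα : α = 1
    · simp only [hα, if_true]
      refine ((hasDerivAt_pow_succ_div_factorial h (Real.log x)).comp x
        (Real.hasDerivAt_log hx.ne')).congr_deriv ?_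
      ring
    · simp only [hα, if_false]
      have hβ : α - 1 ≠ 0 := sub_ne_zero.2 hα
      refine (((hasDerivAt_expRemainder h ((α - 1) * Real.log x)).comp x
        ((Real.hasDerivAt_log hx.ne').const_mul (α - 1))).const_mul
          ((α / (α - 1)) ^ (h + 1))).congr_deriv ?_
      rw [pow_succ]
      field_simp

/-- The limit of the probability that the nearest centroid has depth at least `h`. -/
noncomputable def tailLimit (α : ℝ) (h : ℕ) : ℝ := tailProfile α h 2 / (2 : ℝ) ^ (α - 1)

lemma tailLimit_zero (α : ℝ) : tailLimit α 0 = 1 := by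
  rw [tailLimit, (isTailProfile_tailProfile α).zero 2 two_pos, div_self (by positivity)]

lemma tailLimit_of_ne_one {α : ℝ} (hα : α ≠ 1) (h : ℕ) :
    tailLimit α h = (α / (α - 1)) ^ h * (1 - (2 : ℝ) ^ (1 - α) *
      ∑ j ∈ Finset.range h, ((α - 1) * Real.log 2) ^ j / (j.factorial : ℝ)) := by
  have h1 : Real.exp ((α - 1) * Real.log 2) = (2 : ℝ) ^ (α - 1) := by
    rw [Real.rpow_def_of_pos two_pos, mul_comm]
  have h2 : (2 : ℝ) ^ (1 - α) = ((2 : ℝ) ^ (α - 1))⁻¹ := by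
    rw [← Real.rpow_neg two_pos.le, neg_sub]
  have h3 : (2 : ℝ) ^ (α - 1) ≠ 0 := by positivity
  rw [tailLimit, tailProfile, if_neg hα, expRemainder, h1, h2]
  field_simp

lemma tailLimit_one (h : ℕ) : tailLimit 1 h = Real.log 2 ^ h / (h.factorial : ℝ) := by
  simp [tailLimit, tailProfile]

lemma tailLimit_sub_succ_of_ne_one {α : ℝ} (hα : α ≠ 1) (h : ℕ) :
    tailLimit α h - tailLimit α (h + 1) = α ^ h / (α - 1) ^ (h + 1) *
      ((2 : ℝ) ^ (1 - α) *
        (∑ j ∈ Finset.range h, ((α - 1) * Real.log 2) ^ j / (j.factorial : ℝ) +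
          α * ((α - 1) * Real.log 2) ^ h / (h.factorial : ℝ)) - 1) := by
  have hβ : α - 1 ≠ 0 := sub_ne_zero.2 hα
  rw [tailLimit_of_ne_one hα, tailLimit_of_ne_one hα, Finset.sum_range_succ]
  set S := ∑ j ∈ Finset.range h, ((α - 1) * Real.log 2) ^ j / (j.factorial : ℝ)
  set q := ((α - 1) * Real.log 2) ^ h / (h.factorial : ℝ) with hq
  rw [mul_div_assoc α, ← hq, div_pow, div_pow, pow_succ, pow_succ]
  field_simp
  ring

lemma tendsto_tailLimit (α : ℝ) : Tendsto (tailLimit α) atTop (𝓝 0) := by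
  have h : Tendsto (fun h => tailProfile α h 2) atTop (𝓝 0) := by
    unfold tailProfile
    by_cases hα : α = 1
    · simp only [hα, if_true]
      exact FloorSemiring.tendsto_pow_div_factorial_atTop _
    · simp only [hα, if_false]
      exact tendsto_pow_mul_expRemainder _ _
  unfold tailLimit
  simpa using h.div_const ((2 : ℝ) ^ (α - 1))

lemma treeProb_depth_eq (φ : ℕ → ℝ) (h n : ℕ) :
    treeProb φ n {T | T.depth = h} =
      treeProb φ n {T | h ≤ T.depth} - treeProb φ n {T | h + 1 ≤ T.depth} := by
  classical
  rw [treeProb, treeProb, treeProb, ← sub_div, ← Finset.sum_sub_distrib]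
  congr 1
  refine Finset.sum_congr rfl fun T _ => ?_
  simp only [Set.indicator_apply, Set.mem_ofPred_eq]
  rcases lt_trichotomy T.depth h with hd | hd | hd
  · rw [if_neg (by omega), if_neg (by omega), if_neg (by omega), sub_zero]
  · rw [if_pos hd, if_pos (by omega), if_neg (by omega), sub_zero]
  · rw [if_neg (by omega), if_pos (by omega), if_pos (by omega), sub_self]

/-! ### Probability measures on the natural numbers -/

/-- Convergence of the point masses to those of a probability measure implies weak convergence:
no mass can escape, as the limiting masses sum to one. -/
lemma tendsto_probabilityMeasure_nat {μ : ProbabilityMeasure ℕ} {μs : ℕ → ProbabilityMeasure ℕ}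
    (h : ∀ k, Tendsto (fun n => (μs n : Measure ℕ).real {k}) atTop
      (𝓝 ((μ : Measure ℕ).real {k}))) : Tendsto μs atTop (𝓝 μ) := by
  refine tendsto_of_forall_isOpen_le_liminf' fun G _ => ?_
  have h' : ∀ k, Tendsto (fun n => (μs n : Measure ℕ) {k}) atTop (𝓝 ((μ : Measure ℕ) {k})) :=
    fun k => (ENNReal.tendsto_toReal_iff (fun n => measure_ne_top _ _) (measure_ne_top _ _)).1 (h k)
  rw [← Measure.tsum_indicator_apply_singleton (μ : Measure ℕ) G (MeasurableSet.of_discrete),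
    ENNReal.tsum_eq_iSup_sum]
  refine iSup_le fun s => ?_
  have hlim : Tendsto (fun n => ∑ k ∈ s, G.indicator (fun k => (μs n : Measure ℕ) {k}) k) atTop
      (𝓝 (∑ k ∈ s, G.indicator (fun k => (μ : Measure ℕ) {k}) k)) := by
    refine tendsto_finsetSum _ fun k _ => ?_
    by_cases hk : k ∈ G
    · simpa [hk] using h' k
    · simp [hk]
  rw [← hlim.liminf_eq]
  refine liminf_le_liminf (Eventually.of_forall fun n => ?_)
  rw [← Measure.tsum_indicator_apply_singleton (μs n : Measure ℕ) G (MeasurableSet.of_discrete)]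
  exact ENNReal.sum_le_tsum s

/-- A nonincreasing sequence from `1` to `0` is the sequence of tails of a probability measure. -/
lemma exists_probabilityMeasure_of_tail {t : ℕ → ℝ} (h0 : t 0 = 1) (hlim : Tendsto t atTop (𝓝 0))
    (hmono : ∀ h, 0 ≤ t h - t (h + 1)) :
    ∃ μ : ProbabilityMeasure ℕ, ∀ h, (μ : Measure ℕ).real (Set.Ici h) = t h ∧
      (μ : Measure ℕ).real {h} = t h - t (h + 1) := by
  have hsum : HasSum (fun h => t h - t (h + 1)) 1 := by
    rw [hasSum_iff_tendsto_nat_of_nonneg hmono]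
    simp_rw [Finset.sum_range_sub', h0]
    simpa using hlim.const_sub 1
  let ν : Measure ℕ := Measure.sum fun h => ENNReal.ofReal (t h - t (h + 1)) • Measure.dirac h
  have hν : IsProbabilityMeasure ν := by
    constructor
    rw [Measure.sum_apply _ MeasurableSet.univ]
    simp only [Measure.smul_apply, measure_univ, smul_eq_mul, mul_one]
    rw [← ENNReal.ofReal_tsum_of_nonneg hmono hsum.summable, hsum.tsum_eq, ENNReal.ofReal_one]
  have hpoint : ∀ h, ν.real {h} = t h - t (h + 1) := by
    intro h
    rw [Measure.real, Measure.sum_smul_dirac_singleton, ENNReal.toReal_ofReal (hmono h)]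
  refine ⟨⟨ν, hν⟩, fun h => ⟨?_, hpoint h⟩⟩
  change ν.real (Set.Ici h) = t h
  have hcompl : (Set.Ici h)ᶜ = (Finset.range h : Set ℕ) := by
    ext k
    simp
  have hc := probReal_compl_eq_one_sub (μ := ν) (s := Set.Ici h) (MeasurableSet.of_discrete)
  rw [hcompl, ← sum_measureReal_singleton, Finset.sum_congr rfl (fun k _ => hpoint k),
    Finset.sum_range_sub', h0] at hc
  linarith

lemma treeWeight_nonneg {φ : ℕ → ℝ} (hpos : ∀ i, 0 ≤ φ i) {n : ℕ} (T : PlaneIncreasingTree n) :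
    0 ≤ treeWeight φ T :=
  Finset.prod_nonneg fun _ _ => hpos _

section VerySimple

variable {φ : ℕ → ℝ} {c₁ c₂ α : ℝ}

lemma IsVerySimple.isProbabilityMeasure_depthLaw (hφ : IsVerySimple φ c₁ c₂)
    (hpos : ∀ i, 0 ≤ φ i) (n : ℕ) : IsProbabilityMeasure (depthLaw φ n) := by
  have hy := hφ.totalWeight_pos n
  constructor
  simp only [depthLaw, Measure.coe_finsetSum, Finset.sum_apply, Measure.smul_apply, measure_univ,
    smul_eq_mul, mul_one]
  rw [← ENNReal.ofReal_sum_of_nonneg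
    (fun T _ => div_nonneg (treeWeight_nonneg hpos T) hy.le), ← Finset.sum_div,
    ← totalWeight, div_self hy.ne', ENNReal.ofReal_one]

lemma IsVerySimple.depthLaw_real_singleton (hφ : IsVerySimple φ c₁ c₂)
    (hpos : ∀ i, 0 ≤ φ i) (n h : ℕ) :
    (depthLaw φ n).real {h} = treeProb φ n {T | T.depth = h} := by
  classical
  have hy := hφ.totalWeight_pos n
  rw [Measure.real, depthLaw, Measure.coe_finsetSum, Finset.sum_apply, ENNReal.toReal_sum, treeProb,
    Finset.sum_div]
  · refine Finset.sum_congr rfl fun T _ => ?_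
    rw [Measure.smul_apply, Measure.dirac_apply' _ (MeasurableSet.of_discrete)]
    by_cases hT : T.depth = h
    · simp [hT, ENNReal.toReal_ofReal (div_nonneg (treeWeight_nonneg hpos T) hy.le)]
    · simp [hT]
  · intro T _
    rw [Measure.smul_apply, smul_eq_mul]
    exact ENNReal.mul_ne_top ENNReal.ofReal_ne_top (measure_ne_top _ _)

end VerySimple

theorem mainTheorem3 (φ : ℕ → ℝ) (c₁ c₂ α : ℝ) (hφ : IsVerySimple φ c₁ c₂)
    (hα : α = 1 + c₂ / c₁) :
    ∃ tail mass : ℕ → ℝ,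
      (α ≠ 1 → ∀ h : ℕ,
        tail h = (α / (α - 1)) ^ h *
          (1 - (2 : ℝ) ^ (1 - α) *
            ∑ j ∈ Finset.range h, ((α - 1) * Real.log 2) ^ j / (j.factorial : ℝ)) ∧
        mass h = α ^ h / (α - 1) ^ (h + 1) *
          ((2 : ℝ) ^ (1 - α) *
            (∑ j ∈ Finset.range h, ((α - 1) * Real.log 2) ^ j / (j.factorial : ℝ) +
              α * ((α - 1) * Real.log 2) ^ h / (h.factorial : ℝ)) - 1)) ∧
      (α = 1 → ∀ h : ℕ,
        tail h = Real.log 2 ^ h / (h.factorial : ℝ) ∧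
        mass h = Real.log 2 ^ h / (h.factorial : ℝ) -
          Real.log 2 ^ (h + 1) / ((h + 1).factorial : ℝ)) ∧
      (∀ h : ℕ,
        Tendsto (fun n : ℕ => treeProb φ n {T | h ≤ T.depth}) atTop (𝓝 (tail h)) ∧
        Tendsto (fun n : ℕ => treeProb φ n {T | T.depth = h}) atTop (𝓝 (mass h))) ∧
      ((∀ i, 0 ≤ φ i) →
        ∃ 𝒟 : ProbabilityMeasure ℕ,
          (∀ h : ℕ, (𝒟 : Measure ℕ).real (Set.Ici h) = tail h ∧
            (𝒟 : Measure ℕ).real {h} = mass h) ∧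
          ∃ law : ℕ → ProbabilityMeasure ℕ,
            (∀ n : ℕ, (law n : Measure ℕ) = depthLaw φ n) ∧ Tendsto law atTop (𝓝 𝒟)) := by
  have htail : ∀ h, Tendsto (fun n : ℕ => treeProb φ n {T | h ≤ T.depth}) atTop
      (𝓝 (tailLimit α h)) :=
    fun h => hφ.tendsto_treeProb_le_depth hα (isTailProfile_tailProfile α) h
  have hmass : ∀ h, Tendsto (fun n : ℕ => treeProb φ n {T | T.depth = h}) atTop
      (𝓝 (tailLimit α h - tailLimit α (h + 1))) := by
    intro h
    simp_rw [treeProb_depth_eq]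
    exact (htail h).sub (htail (h + 1))
  refine ⟨tailLimit α, fun h => tailLimit α h - tailLimit α (h + 1), ?_, ?_,
    fun h => ⟨htail h, hmass h⟩, ?_⟩
  · exact fun h1 h => ⟨tailLimit_of_ne_one h1 h, tailLimit_sub_succ_of_ne_one h1 h⟩
  · rintro rfl h
    simp only [tailLimit_one, and_self]
  · intro hpos
    have hnonneg : ∀ h, 0 ≤ tailLimit α h - tailLimit α (h + 1) := by
      intro h
      refine ge_of_tendsto' (hmass h) fun n => ?_
      exact div_nonneg (Finset.sum_nonneg fun T _ =>
        Set.indicator_nonneg (fun T _ => treeWeight_nonneg hpos T) T) (hφ.totalWeight_pos n).le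
    obtain ⟨𝒟, h𝒟⟩ := exists_probabilityMeasure_of_tail (tailLimit_zero α) (tendsto_tailLimit α)
      hnonneg
    refine ⟨𝒟, h𝒟, fun n => ⟨depthLaw φ n, hφ.isProbabilityMeasure_depthLaw hpos n⟩,
      fun n => rfl, tendsto_probabilityMeasure_nat fun k => ?_⟩
    rw [(h𝒟 k).2]
    refine (hmass k).congr fun n => ?_
    exact (hφ.depthLaw_real_singleton hpos n k).symm
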